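/- \textbf{Setting.} Let $q(x)=\tfrac12\|x\|^2$ on $\mathbb R^d$, $B_r$ the closed Euclidean ball of radius $r$ centred at $0$, and $z^*(y)=\sup_{x\in\mathbb R^d}\langle x,y\rangle-z(x)$ the Legendre transform. Let $\varphi:\mathbb R_+\to\mathbb R_+\cup\{+\infty\}$ be convex and lower semicontinuous with $\varphi(1)=0$, and $\varphi^*(s)=\sup_{r\ge0}rs-\varphi(r)$. For measures $\mu,\nu$ put $J_{\mu,\nu}(z)=\langle\varphi^*(z-q),\mu\rangle+\langle\varphi^*(z^*-q),\nu\rangle$. Let $\mu,\nu$ be probability measures carried by compact sets $X,Y\subset\mathbb R^d$. A function $z_0$ is an unbalanced optimal transport potential between $\mu$ and $\nu$ if the pair $(q-z_0,\,q-z_0^*)$ maximizes $-\langle\varphi^*(-u),\mu\rangle-\langle\varphi^*(-v),\nu\rangle$ over the pairs of functions $u$ continuous on $X$ and $v$ continuous on $Y$ such that $u(x)+v(y)\le q(x-y)$ for all $(x,y)\in X\times Y$. For $\lambda>0$ and $C'\ge0$, with $\tilde\nu=(\varphi^*)'(z_0^*-q)\,\nu$, put $$d_{H^\circ}^\lambda(f,g)^2=\frac1{2\lambda}\mathbb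 E_{\tilde\nu}\big[\|\nabla(f^*-g^*)\|^2\big]+C'\Big(\mathbb E_\nu\big[(f^*-g^*)^2\big]+\mathbb E_\mu\big[(f-g)^2\big]\Big).$$ Given $M:\mathbb R\to\mathbb R$, $R,l\in\mathbb R$ and $\lambda>0$, let $G(r)=\frac r\lambda+\sqrt{2(M(0)-l)/\lambda}$, $M^*(r)=rG(r)+M(G(r))$ and $K=\max\big(2M(R)+R^2,\;2M^*(R)+R^2\big)$. Assume that $\varphi^*$ is finite in a neighbourhood of, and differentiable at, each point of $[-K,K]$, and that $C'\ge0$ is such that $\varphi^*$ is $C'$-strongly convex on $[-K,K]$ ($C'=0$ is always allowed). \textbf{Proposition.} There are $R'=R'(M,R,\lambda,l)>0$, $M'=M'(M,R,\lambda,l,\varphi)>0$ and $L=L(M,R,\lambda,l,\varphi)>0$, depending only on the indicated data, such that the following holds in every dimension $d$. Suppose that 1. $\mu$ and $\nu$ are supported in $B_R$; 2. $\mu$ and $\nu$ have densities with respect to the Lebesgue measure; 3. an unbalanced optimal transport potential $z_0$ between $\mu$ and $\nu$ belongs to $C$, where $C$ is a set of functions $\mathbb R^d\to\mathbb R$; 4.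 every $z\in C$ is $\lambda$-strongly convex, satisfies $z\ge l$, and satisfies $|z|\le M(r)$ on $B_r$ for every $r$. Let $n\ge1$, let $\hat\mu,\hat\nu$ be the empirical measures of $n$ independent samples of $\mu$ and of $\nu$, and let $\hat z_C$ be (almost surely) a minimizer of $J_{\hat\mu,\hat\nu}$ over $C$. Then for all $0\le\delta\le M'/L$ $$\mathbb E\big[d_{H^\circ}^\lambda(\hat z_C,z_0)^2\big]\le 64\left(\delta+\frac1{\sqrt n}\int_{\delta/4}^{M'/L}\sqrt{\log N\big(C,L^\infty_{B_{R'}},Lu\big)}\,\mathrm du\right),$$ where $N(C,L^\infty_{B_{R'}},\varepsilon)$ is the minimal number of balls of radius $\varepsilon$ for the norm $\|\cdot\|_{L^\infty(B_{R'})}$ that cover $C$. -/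

import Mathlib

open MeasureTheory ProbabilityTheory Set Filter Topology
open scoped NNReal ENNReal

noncomputable section

namespace UOT

/-- The Euclidean space `ℝ^d`. -/
abbrev E (d : ℕ) : Type := EuclideanSpace ℝ (Fin d)

/-! ### Entropy functions and their conjugates -/

/-- Entropy functions: convex lower semicontinuous `φ : ℝ₊ → ℝ₊ ∪ {+∞}` with `φ(1) = 0`. -/
structure IsEntropy (φ : ℝ≥0 → ℝ≥0∞) : Prop where
  convex : ConvexOn ℝ≥0 Set.univ φ
  lsc : LowerSemicontinuous φ
  one : φ 1 = 0

/-- The Legendre transform `φ^*(s) = sup_{r ≥ 0} (r s - φ(r))`, with values in `(-∞, +∞]`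
when `φ(1) = 0`. -/
def entropyConj (φ : ℝ≥0 → ℝ≥0∞) (s : ℝ) : EReal :=
  ⨆ r : ℝ≥0, ((((r : ℝ) * s : ℝ) : EReal) - ((φ r : ℝ≥0∞) : EReal))

/-- The real-valued version of `φ^*`, meaningful where `φ^*` is finite. -/
def entropyConjReal (φ : ℝ≥0 → ℝ≥0∞) (s : ℝ) : ℝ := (entropyConj φ s).toReal

/-- `φ^*` is finite in a neighbourhood of, and differentiable at, each point of `[-K, K]`. -/
def ConjDifferentiableOn (φ : ℝ≥0 → ℝ≥0∞) (K : ℝ) : Prop :=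
  ∀ s ∈ Icc (-K) K,
    (∀ᶠ t in 𝓝 s, entropyConj φ t ≠ ⊤) ∧ DifferentiableAt ℝ (entropyConjReal φ) s

open Classical in
/-- The pairing `⟨φ^*(f), ρ⟩`, with values in `(-∞, +∞]`. As `φ^*(s) ≥ s`, for `f` bounded below
it is the usual extended integral: it is `+∞` unless `φ^*(f)` is a.e. finite and integrable. -/
def conjIntegral {d : ℕ} (φ : ℝ≥0 → ℝ≥0∞) (ρ : Measure (E d)) (f : E d → ℝ) : EReal :=
  if (∀ᵐ x ∂ρ, entropyConj φ (f x) ≠ ⊤) ∧ Integrable (fun x => entropyConjReal φ (f x)) ρ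
  then ((∫ x, entropyConjReal φ (f x) ∂ρ : ℝ) : EReal)
  else ⊤

/-! ### The semi-dual functional and optimal potentials -/

/-- `q(x) = ‖x‖² / 2`. -/
def q {d : ℕ} (x : E d) : ℝ := ‖x‖ ^ 2 / 2

/-- The Legendre transform `z^*(y) = sup_x (⟨x, y⟩ - z(x))` of a potential on `ℝ^d`; the supremum
is finite for all the (finite-valued, strongly convex) potentials to which it is applied. -/
def conj {d : ℕ} (z : E d → ℝ) (y : E d) : ℝ := ⨆ x : E d, (inner ℝ x y - z x)

/-- The semi-dual functional `J_{μ,ν}(z) = ⟨φ^*(z - q), μ⟩ + ⟨φ^*(z^* - q), ν⟩`. -/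
def semiDual {d : ℕ} (φ : ℝ≥0 → ℝ≥0∞) (μ ν : Measure (E d)) (z : E d → ℝ) : EReal :=
  conjIntegral φ μ (fun x => z x - q x) + conjIntegral φ ν (fun y => conj z y - q y)

/-- Admissible pairs of the dual problem: continuous functions on `X` and `Y` such that
`u(x) + v(y) ≤ q(x - y)` on `X × Y`. -/
def DualAdmissible {d : ℕ} (X Y : Set (E d)) (u v : E d → ℝ) : Prop :=
  ContinuousOn u X ∧ ContinuousOn v Y ∧ ∀ x ∈ X, ∀ y ∈ Y, u x + v y ≤ q (x - y)

/-- `z₀` is an (optimal) unbalanced optimal transport potential between `μ` and `ν`, measures on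
`X` and `Y`: the pair `(q - z₀, q - z₀^*)` is admissible for the dual problem
`sup_{u, v} -⟨φ^*(-u), μ⟩ - ⟨φ^*(-v), ν⟩` and optimal in it. -/
def IsPotential {d : ℕ} (φ : ℝ≥0 → ℝ≥0∞) (X Y : Set (E d)) (μ ν : Measure (E d))
    (z₀ : E d → ℝ) : Prop :=
  DualAdmissible X Y (fun x => q x - z₀ x) (fun y => q y - conj z₀ y) ∧
  ∀ u v : E d → ℝ, DualAdmissible X Y u v →
    semiDual φ μ ν z₀ ≤ conjIntegral φ μ (fun x => - u x) + conjIntegral φ ν (fun y => - v y)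

/-- The measure `ν̃ = (φ^*)'(z₀^* - q) ν` (`φ^*` is nondecreasing). -/
def tiltedMeasure {d : ℕ} (φ : ℝ≥0 → ℝ≥0∞) (ν : Measure (E d)) (z₀ : E d → ℝ) : Measure (E d) :=
  ν.withDensity fun y => ENNReal.ofReal (deriv (entropyConjReal φ) (conj z₀ y - q y))

/-- The squared pseudo-distance
`d(f, g)² = 1/(2λ) E_{ν̃} ‖∇(f^* - g^*)‖² + C' (E_ν (f^* - g^*)² + E_μ (f - g)²)`. -/
def distSq {d : ℕ} (φ : ℝ≥0 → ℝ≥0∞) (lam : ℝ) (C' : ℝ≥0) (μ ν : Measure (E d))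
    (z₀ f g : E d → ℝ) : ℝ≥0∞ :=
  ENNReal.ofReal (1 / (2 * lam)) *
      ∫⁻ y, ‖gradient (fun w => conj f w - conj g w) y‖ₑ ^ 2 ∂(tiltedMeasure φ ν z₀) +
    (C' : ℝ≥0∞) *
      ((∫⁻ y, ‖conj f y - conj g y‖ₑ ^ 2 ∂ν) + ∫⁻ x, ‖f x - g x‖ₑ ^ 2 ∂μ)

/-! ### Classes of potentials -/

/-- The functions of `C` are bounded by `M(r)` on `B_r` for every `r`, bounded below by `l` and
`lam`-strongly convex on `ℝ^d`. -/
def BoundedStronglyConvex {d : ℕ} (M : ℝ → ℝ) (l lam : ℝ) (C : Set (E d → ℝ)) : Prop :=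
  ∀ z ∈ C, (∀ r : ℝ, ∀ x : E d, ‖x‖ ≤ r → |z x| ≤ M r) ∧ (∀ x, l ≤ z x) ∧
    StrongConvexOn Set.univ lam z

/-- `G(r) = r/λ + √(2 (M(0) - l) / λ)`. -/
def gradBound (M : ℝ → ℝ) (l lam r : ℝ) : ℝ := r / lam + √(2 * (M 0 - l) / lam)

/-- `M^*(r) = r G(r) + M(G(r))`. -/
def conjBound (M : ℝ → ℝ) (l lam r : ℝ) : ℝ :=
  r * gradBound M l lam r + M (gradBound M l lam r)

/-- `K = max(2 M(R) + R², 2 M^*(R) + R²)`: the arguments `z - q` and `z^* - q` at which `φ^*` is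
evaluated on `B_R` lie in `[-K, K]`. -/
def argBound (M : ℝ → ℝ) (R l lam : ℝ) : ℝ :=
  max (2 * M R + R ^ 2) (2 * conjBound M l lam R + R ^ 2)

/-! ### Metric entropy -/

/-- Functions on `ℝ^d` with the distance `‖f - g‖_{L^∞}` on the ball `B_r`. -/
@[reducible] def linftyBall (d : ℕ) (r : ℝ) : PseudoEMetricSpace (E d → ℝ) where
  edist f g := eLpNorm (f - g) ∞ (volume.restrict (Metric.closedBall 0 r))
  edist_self f := by simp
  edist_comm f g := eLpNorm_sub_comm f g _ _
  edist_triangle f g h := by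
    have e : f - h = (f - g) + (g - h) := by abel
    rw [e]
    simpa only [eLpNorm_exponent_top] using eLpNormEssSup_add_le

/-- The metric entropy `log N(C, L^∞_{B_r}, ε)`, where `N` is the minimal number of balls of radius
`ε` (with arbitrary centres) that cover `C`. -/
def metricEntropy {d : ℕ} (C : Set (E d → ℝ)) (r ε : ℝ) : ℝ≥0∞ :=
  letI := linftyBall d r
  (ENNReal.log ((Metric.externalCoveringNumber ε.toNNReal C : ℕ∞) : ℝ≥0∞)).toENNReal

/-! ### Samples -/

/-- The empirical measure `(1/n) ∑ᵢ δ_{xᵢ}`. -/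
def empirical {d n : ℕ} (x : Fin n → E d) : Measure (E d) :=
  (n : ℝ≥0∞)⁻¹ • ∑ i, Measure.dirac (x i)

/-- `X₁, …, X_n` are independent with common law `ρ`. -/
def IsSample {d n : ℕ} {Ω : Type*} [MeasurableSpace Ω] (P : Measure Ω) (ρ : Measure (E d))
    (X : Fin n → Ω → E d) : Prop :=
  (∀ i, Measurable (X i)) ∧ (∀ i, P.map (X i) = ρ) ∧ iIndepFun X P

end UOT

end

noncomputable section

namespace UOT

/-! ### Conjugate entropies -/

/-! The proof joins a deterministic stability estimate for J at z₀ to a chaining bound for the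
empirical process.

Stability. Since z₀ is optimal, J does not decrease along the segment from z₀ to z ∈ C. To first
order, moving z₀ towards z changes z₀^*(y) by (z₀ - z) evaluated at ∇z₀^*(y), so differentiating at
z₀ gives an optimality inequality (`IsPotential.integral_deriv_le`). Convexity of φ^* bounds J(z) -
J(z₀) below by its linearization in (z - z₀, z^* - z₀^*), plus C'/2 times the squared differences.
By strong convexity of z, the difference z^* - z₀^* exceeds that first order change by at least λ/2
‖∇z^* - ∇z₀^*‖² (`sq_norm_sub_conjArg_le`). As (φ^*)' ≥ 0, this gap can be integrated against ν̃,
and the optimality inequality removes the remaining terms (`IsPotential.stability`). Hence d² is at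
most a constant times J(z) - J(z₀).

Chaining. The estimator minimizes the empirical functional, so its excess is at most the increment
of J - Ĵ between z₀ and the estimator. If two potentials are ε-close in L^∞(B_{R'}), their
conjugates are ε-close on B_R (`conj_sub_conj_le`), and φ^* is Λ-Lipschitz on [-K, K]. The
increments are therefore at most 4Λε and, by Hoeffding, subgaussian with parameter (2Λε/√n)²;
`dudley_bound` then applies. Every bound comes from M, R, l, λ and φ, so no constant sees the
dimension. -/

theorem entropyConj_le_coe_iff {φ : ℝ≥0 → ℝ≥0∞} {s c : ℝ} :
    entropyConj φ s ≤ (c : EReal) ↔ ∀ r : ℝ≥0, φ r ≠ ⊤ → (r : ℝ) * s - (φ r).toReal ≤ c := by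
  unfold entropyConj
  rw [iSup_le_iff]
  refine forall_congr' fun r => ?_
  by_cases hr : φ r = ⊤
  · simp [hr]
  · lift φ r to ℝ≥0 using hr with a
    simp only [ne_eq, ENNReal.coe_ne_top, not_false_eq_true, ENNReal.coe_toReal, forall_const]
    rw [← EReal.coe_le_coe_iff]
    simp only [EReal.coe_sub, EReal.coe_mul]
    rfl

theorem coe_le_entropyConj {φ : ℝ≥0 → ℝ≥0∞} (h1 : φ 1 = 0) (s : ℝ) :
    (s : EReal) ≤ entropyConj φ s := by
  refine le_trans ?_ (le_iSup _ (1 : ℝ≥0))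
  simp [h1]

theorem coe_entropyConjReal {φ : ℝ≥0 → ℝ≥0∞} (h1 : φ 1 = 0) {s : ℝ} (hs : entropyConj φ s ≠ ⊤) :
    (entropyConjReal φ s : EReal) = entropyConj φ s :=
  EReal.coe_toReal hs fun h => by
    have := coe_le_entropyConj h1 s
    rw [h] at this
    simp at this

theorem entropyConj_mono (φ : ℝ≥0 → ℝ≥0∞) : Monotone (entropyConj φ) := by
  intro s t hst
  refine iSup_mono fun r => EReal.sub_le_sub ?_ le_rfl
  exact_mod_cast mul_le_mul_of_nonneg_left hst r.2

theorem entropyConjReal_monotoneOn {φ : ℝ≥0 → ℝ≥0∞} (h1 : φ 1 = 0) {a : ℝ}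
    (ha : entropyConj φ a ≠ ⊤) : MonotoneOn (entropyConjReal φ) (Iic a) := by
  intro s hs t ht hst
  have hs' := ne_top_of_le_ne_top ha (entropyConj_mono φ hs)
  have ht' := ne_top_of_le_ne_top ha (entropyConj_mono φ ht)
  rw [← EReal.coe_le_coe_iff, coe_entropyConjReal h1 hs', coe_entropyConjReal h1 ht']
  exact entropyConj_mono φ hst

/-- A supremum of affine functions of s is convex; finiteness at a spreads to all of `Iic a` because
φ^* is nondecreasing, the slopes r being nonnegative. -/
theorem entropyConjReal_convexOn {φ : ℝ≥0 → ℝ≥0∞} (h1 : φ 1 = 0) {a : ℝ}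
    (ha : entropyConj φ a ≠ ⊤) : ConvexOn ℝ (Iic a) (entropyConjReal φ) := by
  have key : ∀ s ∈ Iic a, entropyConj φ s = (entropyConjReal φ s : EReal) := fun s hs =>
    (coe_entropyConjReal h1 (ne_top_of_le_ne_top ha (entropyConj_mono φ hs))).symm
  refine ⟨convex_Iic a, fun s hs t ht b c hb hc hbc => ?_⟩
  have hm := convex_Iic a hs ht hb hc hbc
  rw [← EReal.coe_le_coe_iff, ← key _ hm, entropyConj_le_coe_iff]
  intro r hr
  have es := entropyConj_le_coe_iff.1 (key s hs).le r hr
  have et := entropyConj_le_coe_iff.1 (key t ht).le r hr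
  simp only [smul_eq_mul]
  calc (r : ℝ) * (b * s + c * t) - (φ r).toReal
      = b * (r * s - (φ r).toReal) + c * (r * t - (φ r).toReal) := by
        linear_combination (φ r).toReal * (hbc)
    _ ≤ _ := by gcongr

theorem ConvexOn.sub_le_of_Iic {f : ℝ → ℝ} {a b s t : ℝ} (hf : ConvexOn ℝ (Iic b) f)
    (hab : a < b) (hst : s ≤ t) (hta : t ≤ a) :
    f t - f s ≤ (f b - f a) / (b - a) * (t - s) := by
  rcases hst.eq_or_lt with rfl | hst
  · simp
  have h1 := hf.slope_mono_adjacent (x := s) (y := t) (z := b)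
    (by simp only [mem_Iic]; linarith) self_mem_Iic hst (by linarith)
  have h2 := hf.secant_mono (a := b) (x := t) (y := a) self_mem_Iic
    (by simp only [mem_Iic]; linarith) (by simp only [mem_Iic]; linarith) (by linarith)
    (by linarith) hta
  have e1 : (f t - f b) / (t - b) = (f b - f t) / (b - t) := by
    rw [← neg_sub, ← neg_sub b t, neg_div_neg_eq]
  have e2 : (f a - f b) / (a - b) = (f b - f a) / (b - a) := by
    rw [← neg_sub, ← neg_sub b a, neg_div_neg_eq]
  rw [e1, e2] at h2
  exact (div_le_iff₀ (by linarith)).1 (h1.trans h2)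

/-- Near `[-K, K]` the function `φ^*` coincides with a nondecreasing Lipschitz function. -/
theorem exists_monotone_lipschitz_extension {φ : ℝ≥0 → ℝ≥0∞} (h1 : φ 1 = 0) {K : ℝ} (hK : 0 ≤ K)
    (h : ConjDifferentiableOn φ K) :
    ∃ (ψ : ℝ → ℝ) (Λ : ℝ≥0), 0 < Λ ∧ Monotone ψ ∧ LipschitzWith Λ ψ ∧
      ∀ s ∈ Icc (-K) K, entropyConj φ s ≠ ⊤ ∧ entropyConjReal φ s = ψ s ∧
        HasDerivAt ψ (deriv (entropyConjReal φ) s) s := by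
  obtain ⟨b, hb, hbt⟩ : ∃ b, K < b ∧ entropyConj φ b ≠ ⊤ := by
    have h2 : ∀ᶠ t in 𝓝[>] K, entropyConj φ t ≠ ⊤ :=
      (h K ⟨by linarith, le_rfl⟩).1.filter_mono nhdsWithin_le_nhds
    obtain ⟨b, hb1, hb2⟩ := (h2.and self_mem_nhdsWithin).exists
    exact ⟨b, hb2, hb1⟩
  set f := entropyConjReal φ
  have hc := entropyConjReal_convexOn h1 hbt
  have hm := entropyConjReal_monotoneOn h1 hbt
  obtain ⟨a, hKa, hab⟩ := exists_between hb
  set L := (f b - f a) / (b - a) with hL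
  have hL0 : 0 ≤ L := div_nonneg (sub_nonneg.2 (hm hab.le self_mem_Iic hab.le)) (by linarith)
  -- Freezing φ^* to the right of a, with K < a < b, leaves it unchanged near [-K, K]. Left of a,
  -- convexity bounds every slope by that of the secant over [a, b]; the added 1 only makes the
  -- constant positive.
  refine ⟨fun s => f (min s a), L.toNNReal + 1, by positivity, ?_, ?_, ?_⟩
  · intro s t hst
    exact hm ((min_le_right _ _).trans hab.le) ((min_le_right _ _).trans hab.le)
      (min_le_min_right a hst)
  · refine LipschitzWith.of_le_add_mul _ fun t s => ?_
    simp only [NNReal.coe_add, Real.coe_toNNReal _ hL0, NNReal.coe_one]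
    rcases le_total t s with hts | hst
    · have := hm ((min_le_right t a).trans hab.le) ((min_le_right s a).trans hab.le)
        (min_le_min_right a hts)
      have : 0 ≤ (L + 1) * dist t s := by positivity
      linarith
    · have h3 := ConvexOn.sub_le_of_Iic hc hab (min_le_min_right a hst) (min_le_right t a)
      have h4 : min t a - min s a ≤ dist t s := by
        rw [Real.dist_eq]
        have := abs_min_sub_min_le_max t a s a
        simp only [sub_self, abs_zero, abs_nonneg, sup_of_le_left] at this
        exact (le_abs_self _).trans this
      have h5 : L * (min t a - min s a) ≤ L * dist t s := by gcongr
      have : 0 ≤ dist t s := dist_nonneg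
      linarith
  · intro s hs
    refine ⟨ne_top_of_le_ne_top hbt (entropyConj_mono φ (hs.2.trans hb.le)), ?_, ?_⟩
    · simp [min_eq_left (hs.2.trans hKa.le), f]
    · refine (h s hs).2.hasDerivAt.congr_of_eventuallyEq ?_
      filter_upwards [Iio_mem_nhds (hs.2.trans_lt hKa)] with t ht
      simp [min_eq_left (le_of_lt (mem_Iio.1 ht)), f]

/-- The quadratic lower bound of a strongly convex function by its tangents. -/
theorem StrongConvexOn.tangent_le {s : Set ℝ} {f : ℝ → ℝ} {m a b f' : ℝ}
    (hf : StrongConvexOn s m f) (ha : a ∈ s) (hb : b ∈ s) (hd : HasDerivAt f f' a) :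
    f a + f' * (b - a) + m / 2 * (b - a) ^ 2 ≤ f b := by
  -- Strong convexity between a and b is divided by θ, and θ → 0⁺ turns the difference quotient into
  -- the tangent.
  have h1 : Tendsto (fun θ : ℝ => θ⁻¹ * (f (a + θ * (b - a)) - f a) + m / 2 * (1 - θ) * (b - a) ^ 2)
      (𝓝[>] 0) (𝓝 (f' * (b - a) + m / 2 * (1 - 0) * (b - a) ^ 2)) := by
    refine Tendsto.add ?_ ?_
    · have hd2 : HasDerivAt (fun θ : ℝ => f (a + θ * (b - a))) (f' * (b - a)) 0 := by
        have e : HasDerivAt (fun θ : ℝ => a + θ * (b - a)) (b - a) 0 := by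
          simpa using ((hasDerivAt_id (0 : ℝ)).mul_const (b - a)).const_add a
        exact HasDerivAt.comp (0 : ℝ) (by simpa using hd) e
      have := hd2.tendsto_slope_zero_right
      simpa using this
    · refine Tendsto.mono_left ?_ nhdsWithin_le_nhds
      exact (Continuous.tendsto (by fun_prop) _)
  have h2 : ∀ᶠ θ : ℝ in 𝓝[>] 0,
      θ⁻¹ * (f (a + θ * (b - a)) - f a) + m / 2 * (1 - θ) * (b - a) ^ 2 ≤ f b - f a := by
    have : Ioo (0 : ℝ) 1 ∈ 𝓝[>] (0 : ℝ) := Ioo_mem_nhdsGT one_pos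
    filter_upwards [this] with θ hθ
    have := hf.2 ha hb (by linarith [hθ.2] : 0 ≤ 1 - θ) hθ.1.le (by ring)
    simp only [smul_eq_mul, Real.norm_eq_abs, sq_abs] at this
    have e : (1 - θ) * a + θ * b = a + θ * (b - a) := by ring
    rw [e] at this
    have h3 : f (a + θ * (b - a)) - f a ≤
        θ * (f b - f a - m / 2 * (1 - θ) * (b - a) ^ 2) := by
      linear_combination this
    have h4 := mul_le_mul_of_nonneg_left h3 (inv_nonneg.2 hθ.1.le)
    rw [inv_mul_cancel_left₀ hθ.1.ne'] at h4
    linarith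
  have := le_of_tendsto h1 h2
  linarith

/-! ### Conjugates of strongly convex potentials -/

section StronglyConvex

variable {d : ℕ} {z z' : E d → ℝ} {l lam : ℝ}

theorem continuous_of_strongConvexOn (hlam : 0 < lam) (hz : StrongConvexOn univ lam z) :
    Continuous z := by
  have h : ConvexOn ℝ univ z := strongConvexOn_zero.1 (hz.mono hlam.le)
  exact continuousOn_univ.1 (h.continuousOn isOpen_univ)

theorem exists_forall_inner_sub_le (hlam : 0 < lam) (hz : StrongConvexOn univ lam z)
    (hl : ∀ x, l ≤ z x) (y : E d) :
    ∃ x, ∀ w, inner ℝ w y - z w ≤ inner ℝ x y - z x := by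
  have hc := continuous_of_strongConvexOn hlam hz
  -- Coercivity: strong convexity at the midpoint of w and 0, where z ≥ l, forces growth of z like
  -- λ/4 ‖w‖².
  have hlow : ∀ w, 2 * l - z 0 + ‖w‖ * (lam / 4 * ‖w‖ - ‖y‖) ≤ z w - inner ℝ w y := by
    intro w
    have h1 := hz.2 (mem_univ w) (mem_univ 0) (by norm_num : (0 : ℝ) ≤ 1 / 2)
      (by norm_num : (0 : ℝ) ≤ 1 / 2) (by norm_num)
    have h2 := hl ((1 / 2 : ℝ) • w + (1 / 2 : ℝ) • (0 : E d))
    have h3 := real_inner_le_norm w y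
    simp only [smul_eq_mul, sub_zero] at h1
    nlinarith
  obtain ⟨x, hx⟩ := Continuous.exists_forall_le (f := fun w => z w - inner ℝ w y)
    (by fun_prop) (by
      refine tendsto_atTop_mono hlow (tendsto_atTop_add_const_left _ _ ?_)
      have hn := tendsto_norm_cocompact_atTop (E := E d)
      refine hn.atTop_mul_atTop₀ (tendsto_atTop_add_const_right _ _ ?_)
      exact hn.const_mul_atTop (by positivity))
  exact ⟨x, fun w => by linarith [hx w]⟩

open Classical in
/-- A maximizer of `⟨·, y⟩ - z`, that is, the gradient at `y` of the conjugate of a strongly convex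
function `z`. -/
def conjArg (z : E d → ℝ) (y : E d) : E d :=
  if h : ∃ x, ∀ w, inner ℝ w y - z w ≤ inner ℝ x y - z x then h.choose else 0

theorem inner_sub_le_conjArg (hlam : 0 < lam) (hz : StrongConvexOn univ lam z)
    (hl : ∀ x, l ≤ z x) (y w : E d) :
    inner ℝ w y - z w ≤ inner ℝ (conjArg z y) y - z (conjArg z y) := by
  have h := exists_forall_inner_sub_le hlam hz hl y
  rw [conjArg, dif_pos h]
  exact h.choose_spec w

theorem conj_eq (hlam : 0 < lam) (hz : StrongConvexOn univ lam z) (hl : ∀ x, l ≤ z x) (y : E d) :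
    conj z y = inner ℝ (conjArg z y) y - z (conjArg z y) := by
  have h := inner_sub_le_conjArg hlam hz hl y
  exact le_antisymm (ciSup_le h) (le_ciSup ⟨_, forall_mem_range.2 h⟩ (conjArg z y))

theorem inner_sub_le_conj (hlam : 0 < lam) (hz : StrongConvexOn univ lam z) (hl : ∀ x, l ≤ z x)
    (w y : E d) : inner ℝ w y - z w ≤ conj z y :=
  (inner_sub_le_conjArg hlam hz hl y w).trans_eq (conj_eq hlam hz hl y).symm

/-- The quadratic lower bound of the gap in the Fenchel-Young inequality. -/
theorem sq_norm_sub_conjArg_le (hlam : 0 < lam) (hz : StrongConvexOn univ lam z)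
    (hl : ∀ x, l ≤ z x) (w y : E d) :
    lam / 2 * ‖w - conjArg z y‖ ^ 2 ≤ z w + conj z y - inner ℝ w y := by
  set x := conjArg z y with hx
  have hxe : conj z y = inner ℝ x y - z x := conj_eq hlam hz hl y
  -- Strong convexity on the segment from the maximizer x to w is compared with the maximality of x;
  -- dividing by θ leaves the factor 1 - θ, which tends to 1.
  have h1 : Tendsto (fun θ : ℝ => (1 - θ) * (lam / 2 * ‖w - x‖ ^ 2)) (𝓝[>] 0)
      (𝓝 ((1 - 0) * (lam / 2 * ‖w - x‖ ^ 2))) :=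
    Tendsto.mono_left (Continuous.tendsto (by fun_prop) _) nhdsWithin_le_nhds
  rw [sub_zero, one_mul] at h1
  refine le_of_tendsto h1 ?_
  filter_upwards [Ioo_mem_nhdsGT (one_pos (α := ℝ))] with θ hθ
  have h2 := hz.2 (mem_univ x) (mem_univ w) (by linarith [hθ.2] : 0 ≤ 1 - θ) hθ.1.le (by ring)
  have h3 := inner_sub_le_conj hlam hz hl ((1 - θ) • x + θ • w) y
  rw [inner_add_left, real_inner_smul_left, real_inner_smul_left] at h3
  rw [norm_sub_rev x w] at h2
  simp only [smul_eq_mul] at h2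
  refine le_of_mul_le_mul_left ?_ hθ.1
  rw [hxe] at h3 ⊢
  nlinarith

/-- Adding the quadratic Fenchel-Young gaps at (x, y') and (x', y) gives λ ‖x - x'‖² ≤ ⟨x - x', y -
y'⟩, and Cauchy-Schwarz concludes. -/
theorem norm_conjArg_sub_le (hlam : 0 < lam) (hz : StrongConvexOn univ lam z)
    (hl : ∀ x, l ≤ z x) (y y' : E d) :
    ‖conjArg z y - conjArg z y'‖ ≤ ‖y - y'‖ / lam := by
  set x := conjArg z y with hx
  set x' := conjArg z y' with hx'
  have h1 := sq_norm_sub_conjArg_le hlam hz hl x y'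
  have h2 := sq_norm_sub_conjArg_le hlam hz hl x' y
  rw [conj_eq hlam hz hl, ← hx'] at h1
  rw [conj_eq hlam hz hl, ← hx, norm_sub_rev x' x] at h2
  have h3 : inner ℝ (x - x') (y - y') =
      inner ℝ x y - inner ℝ x y' - inner ℝ x' y + inner ℝ x' y' := by
    rw [inner_sub_left, inner_sub_right, inner_sub_right]; ring
  have h4 := real_inner_le_norm (x - x') (y - y')
  have h5 : lam * ‖x - x'‖ ^ 2 ≤ ‖x - x'‖ * ‖y - y'‖ := by linarith
  rw [le_div_iff₀ hlam]
  rcases (norm_nonneg (x - x')).eq_or_lt with h0 | h0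
  · rw [← h0]; simp
  · refine le_of_mul_le_mul_left ?_ h0
    linarith

theorem continuous_conjArg (hlam : 0 < lam) (hz : StrongConvexOn univ lam z)
    (hl : ∀ x, l ≤ z x) : Continuous (conjArg z) := by
  refine (LipschitzWith.of_dist_le_mul (K := (1 / lam).toNNReal) fun y y' => ?_).continuous
  rw [dist_eq_norm, dist_eq_norm, Real.coe_toNNReal _ (by positivity)]
  exact (norm_conjArg_sub_le hlam hz hl y y').trans_eq (by ring)

/-- Each maximizer is a competitor at the other point. The remainder is thus nonnegative and at most
⟨x' - x, y' - y⟩, where x and x' are the maximizers at y and y'; this is O(‖y' - y‖²) by the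
Lipschitz bound. -/
theorem hasGradientAt_conj (hlam : 0 < lam) (hz : StrongConvexOn univ lam z)
    (hl : ∀ x, l ≤ z x) (y : E d) : HasGradientAt (conj z) (conjArg z y) y := by
  rw [hasGradientAt_iff_isLittleO]
  refine Asymptotics.IsBigO.trans_isLittleO (g := fun y' => ‖y' - y‖ ^ 2)
    (Asymptotics.IsBigO.of_bound (1 / lam) (Eventually.of_forall fun y' => ?_)) ?_
  · have h1 := inner_sub_le_conj hlam hz hl (conjArg z y) y'
    have h2 := inner_sub_le_conj hlam hz hl (conjArg z y') y
    have e1 := conj_eq hlam hz hl y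
    have e2 := conj_eq hlam hz hl y'
    have h3 : inner ℝ (conjArg z y' - conjArg z y) (y' - y) =
        inner ℝ (conjArg z y') y' - inner ℝ (conjArg z y') y
          - inner ℝ (conjArg z y) y' + inner ℝ (conjArg z y) y := by
      rw [inner_sub_left, inner_sub_right, inner_sub_right]; ring
    have h4 := real_inner_le_norm (conjArg z y' - conjArg z y) (y' - y)
    have h5 := mul_le_mul_of_nonneg_right (norm_conjArg_sub_le hlam hz hl y' y)
      (norm_nonneg (y' - y))
    rw [inner_sub_right, Real.norm_eq_abs, abs_of_nonneg (by linarith), norm_pow, norm_norm]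
    calc _ ≤ ‖y' - y‖ / lam * ‖y' - y‖ := by linarith
      _ = _ := by ring
  · have h : (fun y' : E d => ‖y' - y‖ ^ 2) =o[𝓝 y] fun y' => ‖y' - y‖ :=
      (Asymptotics.isLittleO_pow_id one_lt_two).comp_tendsto (k := fun y' : E d => ‖y' - y‖) (by
        have : Tendsto (fun y' : E d => ‖y' - y‖) (𝓝 y) (𝓝 ‖y - y‖) :=
          Continuous.tendsto (by fun_prop) _
        simpa using this)
    exact h.trans_isBigO (Asymptotics.isBigO_refl _ _).norm_left

theorem continuous_conj (hlam : 0 < lam) (hz : StrongConvexOn univ lam z)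
    (hl : ∀ x, l ≤ z x) : Continuous (conj z) :=
  continuous_iff_continuousAt.2 fun y => (hasGradientAt_conj hlam hz hl y).continuousAt

theorem gradient_conj_sub_conj (hlam : 0 < lam) (hz : StrongConvexOn univ lam z)
    (hl : ∀ x, l ≤ z x) (hz' : StrongConvexOn univ lam z') (hl' : ∀ x, l ≤ z' x) (y : E d) :
    gradient (fun w => conj z w - conj z' w) y = conjArg z y - conjArg z' y := by
  have h1 := (hasGradientAt_conj hlam hz hl y).hasFDerivAt.sub
    (hasGradientAt_conj hlam hz' hl' y).hasFDerivAt
  rw [← map_sub] at h1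
  exact (hasGradientAt_iff_hasFDerivAt.2 h1).gradient

end StronglyConvex

/-! ### Bounds uniform over a class of potentials -/

section Bounds

variable {d : ℕ} {z z' z₀ : E d → ℝ} {M : ℝ → ℝ} {l lam : ℝ} {C : Set (E d → ℝ)}

/-- At y = 0 the maximizer x₀ satisfies λ/2 ‖x₀‖² ≤ z(0) - z(x₀) ≤ M(0) - l, and the 1/λ-Lipschitz
bound carries this to B_r. This is the origin of `gradBound`. -/
theorem norm_conjArg_le (hlam : 0 < lam) (hC : BoundedStronglyConvex M l lam C) (hz : z ∈ C)
    {r : ℝ} {y : E d} (hy : ‖y‖ ≤ r) : ‖conjArg z y‖ ≤ gradBound M l lam r := by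
  obtain ⟨hM, hl, hs⟩ := hC z hz
  have h1 := norm_conjArg_sub_le hlam hs hl y 0
  rw [sub_zero] at h1
  have h2 := sq_norm_sub_conjArg_le hlam hs hl 0 0
  rw [conj_eq hlam hs hl] at h2
  simp only [zero_sub, norm_neg, inner_zero_right] at h2
  have h3 : ‖conjArg z 0‖ ≤ √(2 * (M 0 - l) / lam) := by
    refine Real.le_sqrt_of_sq_le ?_
    rw [le_div_iff₀ hlam]
    have := (abs_le.1 (hM 0 0 (by simp))).2
    have := hl (conjArg z 0)
    linarith
  have h4 : ‖conjArg z y‖ ≤ ‖conjArg z y - conjArg z 0‖ + ‖conjArg z 0‖ :=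
    norm_le_norm_sub_add _ _
  have h5 : ‖y‖ / lam ≤ r / lam := by gcongr
  rw [gradBound]
  linarith

theorem gradBound_nonneg (hlam : 0 < lam) {r : ℝ} (hr : 0 ≤ r) : 0 ≤ gradBound M l lam r := by
  unfold gradBound
  positivity

theorem abs_conj_le (hlam : 0 < lam) (hC : BoundedStronglyConvex M l lam C) (hz : z ∈ C)
    {r : ℝ} {y : E d} (hy : ‖y‖ ≤ r) : |conj z y| ≤ conjBound M l lam r := by
  obtain ⟨hM, hl, hs⟩ := hC z hz
  have hr : 0 ≤ r := (norm_nonneg y).trans hy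
  have hG := gradBound_nonneg (M := M) (l := l) hlam hr
  rw [conjBound, abs_le]
  constructor
  · have h1 := inner_sub_le_conj hlam hs hl 0 y
    have h2 := (abs_le.1 (hM (gradBound M l lam r) 0 (by simpa using hG))).2
    rw [inner_zero_left] at h1
    have : 0 ≤ r * gradBound M l lam r := by positivity
    linarith
  · have hx := norm_conjArg_le hlam hC hz hy
    have h1 := (abs_le.1 (hM _ _ hx)).1
    have h2 := real_inner_le_norm (conjArg z y) y
    have h3 : ‖conjArg z y‖ * ‖y‖ ≤ gradBound M l lam r * r := by gcongr
    rw [conj_eq hlam hs hl]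
    linarith

/-- Both maximizers at y lie in the ball of radius G(r), and each is a competitor for the other
potential; closeness on that ball suffices. -/
theorem conj_sub_conj_le (hlam : 0 < lam) (hC : BoundedStronglyConvex M l lam C) (hz : z ∈ C)
    (hz' : z' ∈ C) {r ε : ℝ} (h : ∀ x : E d, ‖x‖ ≤ gradBound M l lam r → |z x - z' x| ≤ ε)
    {y : E d} (hy : ‖y‖ ≤ r) : |conj z y - conj z' y| ≤ ε := by
  obtain ⟨-, hl, hs⟩ := hC z hz
  obtain ⟨-, hl', hs'⟩ := hC z' hz'
  rw [abs_le]
  have h1 := inner_sub_le_conj hlam hs hl (conjArg z' y) y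
  have h2 := inner_sub_le_conj hlam hs' hl' (conjArg z y) y
  have h3 := abs_le.1 (h _ (norm_conjArg_le hlam hC hz hy))
  have h4 := abs_le.1 (h _ (norm_conjArg_le hlam hC hz' hy))
  have e1 := conj_eq hlam hs hl y
  have e2 := conj_eq hlam hs' hl' y
  constructor <;> linarith

/-- The bounds on a class of potentials pass to segments. -/
theorem boundedStronglyConvex_segment (hC : BoundedStronglyConvex M l lam C) (hz₀ : z₀ ∈ C)
    (hz : z ∈ C) : BoundedStronglyConvex M l lam
      {f | ∃ t ∈ Icc (0 : ℝ) 1, f = fun x => z₀ x + t * (z x - z₀ x)} := by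
  rintro _ ⟨t, ht, rfl⟩
  obtain ⟨hM, hl, hs⟩ := hC z hz
  obtain ⟨hM₀, hl₀, hs₀⟩ := hC z₀ hz₀
  have h1t : 0 ≤ 1 - t := by linarith [ht.2]
  refine ⟨fun r x hx => ?_, fun x => ?_, convex_univ, fun x _ y _ a b ha hb hab => ?_⟩
  · have h1 := abs_le.1 (hM r x hx)
    have h2 := abs_le.1 (hM₀ r x hx)
    rw [abs_le]
    constructor <;> nlinarith [ht.1]
  · nlinarith [hl x, hl₀ x, ht.1]
  · have h1 := mul_le_mul_of_nonneg_left (hs.2 (mem_univ x) (mem_univ y) ha hb hab) ht.1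
    have h2 := mul_le_mul_of_nonneg_left (hs₀.2 (mem_univ x) (mem_univ y) ha hb hab) h1t
    simp only [smul_eq_mul] at h1 h2 ⊢
    linear_combination h1 + h2

end Bounds

/-! ### Stability of the semi-dual functional -/

/-- On `[-K, K]` the function `φ^*` is finite and coincides with `ψ`, which is differentiable
there. -/
def IsConjExtension (φ : ℝ≥0 → ℝ≥0∞) (K : ℝ) (ψ : ℝ → ℝ) : Prop :=
  ∀ s ∈ Icc (-K) K, entropyConj φ s ≠ ⊤ ∧ entropyConjReal φ s = ψ s ∧
    HasDerivAt ψ (deriv (entropyConjReal φ) s) s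

/-- The real-valued semi-dual functional attached to `ψ`. -/
def realSemiDual {d : ℕ} (ψ : ℝ → ℝ) (μ ν : Measure (E d)) (z : E d → ℝ) : ℝ :=
  ∫ x, ψ (z x - q x) ∂μ + ∫ y, ψ (conj z y - q y) ∂ν

section Stability

variable {d : ℕ} {φ : ℝ≥0 → ℝ≥0∞} {ψ : ℝ → ℝ} {Λ : ℝ≥0} {K R l lam : ℝ} {M : ℝ → ℝ}
  {μ ν ρ : Measure (E d)} {C : Set (E d → ℝ)} {z z₀ : E d → ℝ} {C' : ℝ≥0}

theorem continuous_q : Continuous (q : E d → ℝ) := by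
  unfold q
  fun_prop

theorem ae_norm_le (hρ : ρ (Metric.closedBall 0 R)ᶜ = 0) : ∀ᵐ x ∂ρ, ‖x‖ ≤ R := by
  filter_upwards [measure_eq_zero_iff_ae_notMem.1 hρ] with x hx
  simpa using hx

theorem integrable_of_continuous [IsFiniteMeasure ρ] (hρ : ρ (Metric.closedBall 0 R)ᶜ = 0)
    {f : E d → ℝ} (hf : Continuous f) : Integrable f ρ := by
  have h1 : IntegrableOn f (Metric.closedBall 0 R) ρ :=
    hf.continuousOn.integrableOn_compact (isCompact_closedBall _ _)
  rwa [IntegrableOn, Measure.restrict_eq_self_of_ae_mem] at h1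
  filter_upwards [ae_norm_le hρ] with x hx
  simpa using hx

theorem sub_q_mem_Icc (hC : BoundedStronglyConvex M l lam C) (hz : z ∈ C) {x : E d}
    (hx : ‖x‖ ≤ R) : z x - q x ∈ Icc (-argBound M R l lam) (argBound M R l lam) := by
  have h1 := abs_le.1 ((hC z hz).1 R x hx)
  have h2 : ‖x‖ ^ 2 ≤ R ^ 2 := by gcongr
  have h3 : 2 * M R + R ^ 2 ≤ argBound M R l lam := le_max_left _ _
  have h4 := sq_nonneg ‖x‖
  unfold q
  constructor <;> linarith

theorem conj_sub_q_mem_Icc (hlam : 0 < lam) (hC : BoundedStronglyConvex M l lam C) (hz : z ∈ C)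
    {y : E d} (hy : ‖y‖ ≤ R) :
    conj z y - q y ∈ Icc (-argBound M R l lam) (argBound M R l lam) := by
  have h1 := abs_le.1 (abs_conj_le hlam hC hz hy)
  have h2 : ‖y‖ ^ 2 ≤ R ^ 2 := by gcongr
  have h3 : 2 * conjBound M l lam R + R ^ 2 ≤ argBound M R l lam := le_max_right _ _
  have h4 := sq_nonneg ‖y‖
  unfold q
  constructor <;> linarith

theorem conjIntegral_eq [IsFiniteMeasure ρ] (hρ : ρ (Metric.closedBall 0 R)ᶜ = 0)
    (hψ : IsConjExtension φ K ψ) (hψc : Continuous ψ) {f : E d → ℝ} (hf : Continuous f)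
    (hfK : ∀ x, ‖x‖ ≤ R → f x ∈ Icc (-K) K) :
    conjIntegral φ ρ f = ((∫ x, ψ (f x) ∂ρ : ℝ) : EReal) := by
  have h1 : (fun x => entropyConjReal φ (f x)) =ᵐ[ρ] fun x => ψ (f x) := by
    filter_upwards [ae_norm_le hρ] with x hx
    exact (hψ _ (hfK x hx)).2.1
  have h2 : ∀ᵐ x ∂ρ, entropyConj φ (f x) ≠ ⊤ := by
    filter_upwards [ae_norm_le hρ] with x hx
    exact (hψ _ (hfK x hx)).1
  have h3 : Integrable (fun x => entropyConjReal φ (f x)) ρ :=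
    (integrable_of_continuous hρ (hψc.comp hf)).congr h1.symm
  rw [conjIntegral, if_pos ⟨h2, h3⟩, integral_congr_ae h1]

theorem semiDual_eq [IsFiniteMeasure μ] [IsFiniteMeasure ν]
    (hμ : μ (Metric.closedBall 0 R)ᶜ = 0) (hν : ν (Metric.closedBall 0 R)ᶜ = 0)
    (hlam : 0 < lam) (hC : BoundedStronglyConvex M l lam C) (hz : z ∈ C)
    (hψ : IsConjExtension φ (argBound M R l lam) ψ) (hψc : Continuous ψ) :
    semiDual φ μ ν z = (realSemiDual ψ μ ν z : EReal) := by
  obtain ⟨-, hl, hs⟩ := hC z hz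
  rw [semiDual, realSemiDual, EReal.coe_add,
    conjIntegral_eq (f := fun x => z x - q x) hμ hψ hψc ((continuous_of_strongConvexOn hlam hs).sub continuous_q)
      fun x hx => sub_q_mem_Icc hC hz hx,
    conjIntegral_eq (f := fun y => conj z y - q y) hν hψ hψc ((continuous_conj hlam hs hl).sub continuous_q)
      fun x hx => conj_sub_q_mem_Icc hlam hC hz hx]

/-- By Fenchel-Young the pair (q - z, q - z^*) is admissible. Membership of z in C is not needed, so
segments may leave C. -/
theorem IsPotential.semiDual_le {X Y : Set (E d)} (h : IsPotential φ X Y μ ν z₀) (hlam : 0 < lam)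
    (hz : StrongConvexOn univ lam z) (hl : ∀ x, l ≤ z x) :
    semiDual φ μ ν z₀ ≤ semiDual φ μ ν z := by
  have h1 := h.2 (fun x => q x - z x) (fun y => q y - conj z y)
    ⟨(continuous_q.sub (continuous_of_strongConvexOn hlam hz)).continuousOn,
      (continuous_q.sub (continuous_conj hlam hz hl)).continuousOn, fun x _ y _ => by
        have h2 := inner_sub_le_conj hlam hz hl x y
        have h3 : q (x - y) = q x + q y - inner ℝ x y := by
          unfold q
          rw [norm_sub_sq_real]
          ring
        linarith⟩
  simpa only [neg_sub, semiDual] using h1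

theorem abs_deriv_le (hψ : IsConjExtension φ K ψ) (hψl : LipschitzWith Λ ψ) {s : ℝ}
    (hs : s ∈ Icc (-K) K) : |deriv (entropyConjReal φ) s| ≤ Λ := by
  rw [← (hψ s hs).2.2.deriv]
  exact norm_deriv_le_of_lipschitz hψl

theorem deriv_nonneg (hψ : IsConjExtension φ K ψ) (hψm : Monotone ψ) {s : ℝ}
    (hs : s ∈ Icc (-K) K) : 0 ≤ deriv (entropyConjReal φ) s := by
  rw [← (hψ s hs).2.2.deriv, ← derivWithin_univ]
  exact (hψm.monotoneOn univ).derivWithin_nonneg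

theorem integrable_deriv_mul [IsFiniteMeasure ρ] (hρ : ρ (Metric.closedBall 0 R)ᶜ = 0)
    (hψ : IsConjExtension φ K ψ) (hψl : LipschitzWith Λ ψ) {a b : E d → ℝ} (ha : Continuous a)
    (haK : ∀ x, ‖x‖ ≤ R → a x ∈ Icc (-K) K) (hb : Continuous b) :
    Integrable (fun x => deriv (entropyConjReal φ) (a x) * b x) ρ := by
  refine (integrable_of_continuous hρ hb).bdd_mul (c := Λ)
    ((measurable_deriv _).comp ha.measurable).aestronglyMeasurable ?_
  filter_upwards [ae_norm_le hρ] with x hx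
  exact abs_deriv_le hψ hψl (haK x hx)

/-- The term t² c makes room for the second order error in the conjugate of a perturbed potential;
it does not affect the derivative at 0. -/
theorem hasDerivAt_integral_comp [IsFiniteMeasure ρ] (hρ : ρ (Metric.closedBall 0 R)ᶜ = 0)
    (hψ : IsConjExtension φ K ψ) (hψl : LipschitzWith Λ ψ) {a b : E d → ℝ} (ha : Continuous a)
    (haK : ∀ x, ‖x‖ ≤ R → a x ∈ Icc (-K) K) (hb : Continuous b) (c : ℝ) :
    HasDerivAt (fun t => ∫ x, ψ (a x + (t * b x + t ^ 2 * c)) ∂ρ)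
      (∫ x, deriv (entropyConjReal φ) (a x) * b x ∂ρ) 0 := by
  have hψc := hψl.continuous
  refine (hasDerivAt_integral_of_dominated_loc_of_lip
    (bound := fun x => Λ * (|b x| + 2 * |c|)) (s := Ioo (-1) 1)
    (Ioo_mem_nhds (by norm_num) (by norm_num)) (Eventually.of_forall fun t => ?_) ?_
    (integrable_deriv_mul hρ hψ hψl ha haK hb).aestronglyMeasurable
    (Eventually.of_forall fun x => ?_) ?_ ?_).2
  · exact Continuous.aestronglyMeasurable (by fun_prop)
  · exact integrable_of_continuous hρ (by fun_prop)
  · refine LipschitzOnWith.of_dist_le_mul fun t ht s hs => ?_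
    refine (hψl.dist_le_mul _ _).trans ?_
    rw [Real.coe_nnabs, abs_of_nonneg (by positivity), mul_assoc, Real.dist_eq, Real.dist_eq]
    gcongr
    have e : a x + (t * b x + t ^ 2 * c) - (a x + (s * b x + s ^ 2 * c)) =
        (b x + (t + s) * c) * (t - s) := by ring
    rw [e, abs_mul]
    gcongr
    refine (abs_add_le _ _).trans ?_
    rw [abs_mul]
    gcongr
    rw [abs_le]
    constructor <;> linarith [ht.1, ht.2, hs.1, hs.2]
  · exact integrable_of_continuous hρ (by fun_prop)
  · filter_upwards [ae_norm_le hρ] with x hx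
    have h1 : HasDerivAt (fun t : ℝ => a x + (t * b x + t ^ 2 * c)) (b x) 0 := by
      have := ((((hasDerivAt_id (0 : ℝ)).mul_const (b x)).add
        (((hasDerivAt_id (0 : ℝ)).pow 2).mul_const c))).const_add (a x)
      simpa using this
    have h2 := (hψ _ (haK x hx)).2.2
    refine HasDerivAt.comp (0 : ℝ) ?_ h1
    simpa using h2

theorem exists_lipschitzOnWith (hlam : 0 < lam) (hC : BoundedStronglyConvex M l lam C)
    (hz : z ∈ C) (r : ℝ) : ∃ k : ℝ≥0, LipschitzOnWith k z (Metric.closedBall 0 r) := by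
  obtain ⟨hM, -, hs⟩ := hC z hz
  have h : ConvexOn ℝ univ z := strongConvexOn_zero.1 (hs.mono hlam.le)
  have h2 := (h.subset (subset_univ _) (convex_ball (0 : E d) (r + 2))).lipschitzOnWith_of_abs_le
    one_pos (M := M (r + 2)) fun a ha => hM _ a (by simpa using ha.le)
  exact ⟨_, h2.mono (Metric.closedBall_subset_ball (by linarith))⟩

/-- The linear term evaluates z₀ - z at the unperturbed maximizer x₀. Replacing the true maximizer x
by x₀ costs t k ‖x - x₀‖, which the quadratic gap λ/2 ‖x - x₀‖² absorbs up to t² k² / (2λ). -/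
theorem conj_segment_le (hlam : 0 < lam) (hC : BoundedStronglyConvex M l lam C)
    (hz₀ : z₀ ∈ C) (hz : z ∈ C) {k : ℝ≥0}
    (hk : LipschitzOnWith k (fun x => z x - z₀ x) (Metric.closedBall 0 (gradBound M l lam R)))
    {t : ℝ} (ht : t ∈ Icc (0 : ℝ) 1) {y : E d} (hy : ‖y‖ ≤ R) :
    conj (fun x => z₀ x + t * (z x - z₀ x)) y ≤
      conj z₀ y + (t * (z₀ (conjArg z₀ y) - z (conjArg z₀ y)) + t ^ 2 * (k ^ 2 / (2 * lam))) := by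
  have hCt := boundedStronglyConvex_segment hC hz₀ hz
  have hzt : (fun x => z₀ x + t * (z x - z₀ x)) ∈
      {f | ∃ t ∈ Icc (0 : ℝ) 1, f = fun x => z₀ x + t * (z x - z₀ x)} := ⟨t, ht, rfl⟩
  obtain ⟨-, hlt, hst⟩ := hCt _ hzt
  obtain ⟨-, hl₀, hs₀⟩ := hC _ hz₀
  have hx := norm_conjArg_le hlam hCt hzt hy
  rw [conj_eq hlam hst hlt]
  set x := conjArg (fun x => z₀ x + t * (z x - z₀ x)) y
  have h1 := sq_norm_sub_conjArg_le hlam hs₀ hl₀ x y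
  have hx₀ := norm_conjArg_le hlam hC hz₀ hy
  set x₀ := conjArg z₀ y
  have h2 := hk.dist_le_mul x (by simpa using hx) x₀ (by simpa using hx₀)
  rw [Real.dist_eq, dist_eq_norm] at h2
  have h3 := mul_le_mul_of_nonneg_left (abs_le.1 h2).1 ht.1
  have h4 : t * (k * ‖x - x₀‖) ≤ lam / 2 * ‖x - x₀‖ ^ 2 + t ^ 2 * (k ^ 2 / (2 * lam)) := by
    have h5 : 0 ≤ (lam * ‖x - x₀‖ - t * k) ^ 2 / (2 * lam) := by positivity
    have h6 : (lam * ‖x - x₀‖ - t * k) ^ 2 / (2 * lam) =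
        lam / 2 * ‖x - x₀‖ ^ 2 + t ^ 2 * (k ^ 2 / (2 * lam)) - t * (k * ‖x - x₀‖) := by
      field_simp
      ring
    linarith
  linarith

theorem nonneg_of_hasDerivAt_of_le {F : ℝ → ℝ} {F' : ℝ} (h : HasDerivAt F F' 0)
    (hF : ∀ t ∈ Ioo (0 : ℝ) 1, F 0 ≤ F t) : 0 ≤ F' := by
  refine ge_of_tendsto h.tendsto_slope_zero_right ?_
  filter_upwards [Ioo_mem_nhdsGT (one_pos (α := ℝ))] with t ht
  rw [zero_add, smul_eq_mul]
  exact mul_nonneg (inv_nonneg.2 ht.1.le) (sub_nonneg.2 (hF t ht))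

/-- The first order optimality condition of a potential. -/
theorem IsPotential.integral_deriv_le [IsFiniteMeasure μ] [IsFiniteMeasure ν]
    (hμ : μ (Metric.closedBall 0 R)ᶜ = 0) (hν : ν (Metric.closedBall 0 R)ᶜ = 0)
    (hlam : 0 < lam) (hC : BoundedStronglyConvex M l lam C) (hz₀ : z₀ ∈ C) (hz : z ∈ C)
    (hψ : IsConjExtension φ (argBound M R l lam) ψ) (hψm : Monotone ψ) (hψl : LipschitzWith Λ ψ)
    {X Y : Set (E d)} (h : IsPotential φ X Y μ ν z₀) :
    0 ≤ ∫ x, deriv (entropyConjReal φ) (z₀ x - q x) * (z x - z₀ x) ∂μ +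
      ∫ y, deriv (entropyConjReal φ) (conj z₀ y - q y) *
        (z₀ (conjArg z₀ y) - z (conjArg z₀ y)) ∂ν := by
  obtain ⟨-, hl, hs⟩ := hC z hz
  obtain ⟨-, hl₀, hs₀⟩ := hC z₀ hz₀
  have hzc := continuous_of_strongConvexOn hlam hs
  have hzc₀ := continuous_of_strongConvexOn hlam hs₀
  have hac₀ := continuous_conjArg hlam hs₀ hl₀
  have hcc₀ := continuous_conj hlam hs₀ hl₀
  have hψc := hψl.continuous
  have hq := continuous_q (d := d)
  obtain ⟨k, hk⟩ := exists_lipschitzOnWith hlam hC hz (gradBound M l lam R)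
  obtain ⟨k₀, hk₀⟩ := exists_lipschitzOnWith hlam hC hz₀ (gradBound M l lam R)
  have hk := hk.sub hk₀
  set k' : ℝ≥0 := k + k₀
  -- On the μ side the perturbation is exactly linear, hence c = 0. On the ν side the conjugate is
  -- replaced by its upper bound from `conj_segment_le`, which is legitimate since ψ is
  -- nondecreasing.
  refine nonneg_of_hasDerivAt_of_le
    ((hasDerivAt_integral_comp hμ hψ hψl (hzc₀.sub hq) (fun x hx => sub_q_mem_Icc hC hz₀ hx)
      (hzc.sub hzc₀) 0).add
    (hasDerivAt_integral_comp hν hψ hψl (hcc₀.sub hq)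
      (fun x hx => conj_sub_q_mem_Icc hlam hC hz₀ hx)
      ((hzc₀.comp hac₀).sub (hzc.comp hac₀)) (k' ^ 2 / (2 * lam)))) fun t ht => ?_
  have ht' : t ∈ Icc (0 : ℝ) 1 := ⟨ht.1.le, ht.2.le⟩
  have hCt := boundedStronglyConvex_segment hC hz₀ hz
  have hzt : (fun x => z₀ x + t * (z x - z₀ x)) ∈
      {f | ∃ t ∈ Icc (0 : ℝ) 1, f = fun x => z₀ x + t * (z x - z₀ x)} := ⟨t, ht', rfl⟩
  obtain ⟨-, hlt, hst⟩ := hCt _ hzt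
  have h1 := h.semiDual_le hlam hst hlt
  rw [semiDual_eq hμ hν hlam hC hz₀ hψ hψc, semiDual_eq hμ hν hlam hCt hzt hψ hψc,
    EReal.coe_le_coe_iff] at h1
  unfold realSemiDual at h1
  simp only [Pi.add_apply, zero_mul, add_zero, mul_zero, ne_eq, OfNat.ofNat_ne_zero,
    not_false_eq_true, zero_pow, Function.comp_apply, Pi.sub_apply]
  refine h1.trans (add_le_add (le_of_eq ?_) ?_)
  · congr 1 with x
    congr 1
    ring
  · have hct := continuous_conj hlam hst hlt
    refine integral_mono_ae (integrable_of_continuous hν (by fun_prop))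
      (integrable_of_continuous hν (by fun_prop)) ?_
    filter_upwards [ae_norm_le hν] with y hy
    refine hψm ?_
    have := conj_segment_le hlam hC hz₀ hz hk ht' hy
    linarith

/-- The stability of the semi-dual functional at a potential. -/
theorem IsPotential.stability [IsFiniteMeasure μ] [IsFiniteMeasure ν]
    (hμ : μ (Metric.closedBall 0 R)ᶜ = 0) (hν : ν (Metric.closedBall 0 R)ᶜ = 0)
    (hlam : 0 < lam) (hC : BoundedStronglyConvex M l lam C) (hz₀ : z₀ ∈ C) (hz : z ∈ C)
    (hψ : IsConjExtension φ (argBound M R l lam) ψ) (hψm : Monotone ψ) (hψl : LipschitzWith Λ ψ)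
    (hC' : StrongConvexOn (Icc (-argBound M R l lam) (argBound M R l lam)) (C' : ℝ)
      (entropyConjReal φ))
    {X Y : Set (E d)} (h : IsPotential φ X Y μ ν z₀) :
    lam / 2 * ∫ y, deriv (entropyConjReal φ) (conj z₀ y - q y) *
        ‖conjArg z y - conjArg z₀ y‖ ^ 2 ∂ν +
      C' / 2 * (∫ y, (conj z y - conj z₀ y) ^ 2 ∂ν + ∫ x, (z x - z₀ x) ^ 2 ∂μ) ≤
    realSemiDual ψ μ ν z - realSemiDual ψ μ ν z₀ := by
  obtain ⟨-, hl, hs⟩ := hC z hz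
  obtain ⟨-, hl₀, hs₀⟩ := hC z₀ hz₀
  have hzc := continuous_of_strongConvexOn hlam hs
  have hzc₀ := continuous_of_strongConvexOn hlam hs₀
  have hac := continuous_conjArg hlam hs hl
  have hac₀ := continuous_conjArg hlam hs₀ hl₀
  have hcc := continuous_conj hlam hs hl
  have hcc₀ := continuous_conj hlam hs₀ hl₀
  have hψc := hψl.continuous
  have hq := continuous_q (d := d)
  have hopt := h.integral_deriv_le hμ hν hlam hC hz₀ hz hψ hψm hψl
  have tangent : ∀ a ∈ Icc (-argBound M R l lam) (argBound M R l lam),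
      ∀ b ∈ Icc (-argBound M R l lam) (argBound M R l lam),
      deriv (entropyConjReal φ) a * (b - a) + C' / 2 * (b - a) ^ 2 ≤ ψ b - ψ a := by
    intro a ha b hb
    have hψs : StrongConvexOn (Icc (-argBound M R l lam) (argBound M R l lam)) (C' : ℝ) ψ := by
      refine ⟨hC'.1, fun x hx y hy s t hs ht hst => ?_⟩
      have := hC'.2 hx hy hs ht hst
      rwa [(hψ x hx).2.1, (hψ y hy).2.1, (hψ _ (hC'.1 hx hy hs ht hst)).2.1] at this
    have := StrongConvexOn.tangent_le hψs ha hb (hψ a ha).2.2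
    linarith
  have i1 := integrable_deriv_mul (b := fun x => z x - z₀ x) hμ hψ hψl (hzc₀.sub hq)
    (fun x hx => sub_q_mem_Icc hC hz₀ hx) (by fun_prop)
  have i2 := integrable_deriv_mul (b := fun y => conj z y - conj z₀ y) hν hψ hψl (hcc₀.sub hq)
    (fun x hx => conj_sub_q_mem_Icc hlam hC hz₀ hx) (by fun_prop)
  have i3 := integrable_deriv_mul (b := fun y => z₀ (conjArg z₀ y) - z (conjArg z₀ y)) hν hψ hψl
    (hcc₀.sub hq) (fun x hx => conj_sub_q_mem_Icc hlam hC hz₀ hx) (by fun_prop)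
  have i4 := integrable_deriv_mul (b := fun y => ‖conjArg z y - conjArg z₀ y‖ ^ 2) hν hψ hψl
    (hcc₀.sub hq) (fun x hx => conj_sub_q_mem_Icc hlam hC hz₀ hx) (by fun_prop)
  have i5 : Integrable (fun x => (z x - z₀ x) ^ 2) μ :=
    integrable_of_continuous hμ (by fun_prop)
  have i6 : Integrable (fun y => (conj z y - conj z₀ y) ^ 2) ν :=
    integrable_of_continuous hν (by fun_prop)
  have i7 : Integrable (fun x => ψ (z x - q x)) μ := integrable_of_continuous hμ (by fun_prop)
  have i8 : Integrable (fun x => ψ (z₀ x - q x)) μ := integrable_of_continuous hμ (by fun_prop)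
  have i9 : Integrable (fun x => ψ (conj z x - q x)) ν :=
    integrable_of_continuous hν (by fun_prop)
  have i10 : Integrable (fun x => ψ (conj z₀ x - q x)) ν :=
    integrable_of_continuous hν (by fun_prop)
  simp only [Pi.sub_apply] at i1 i2 i3 i4
  have h1 := integral_mono_ae (i1.add (i5.const_mul (C' / 2 : ℝ))) (i7.sub i8) (by
    filter_upwards [ae_norm_le hμ] with x hx
    have := tangent _ (sub_q_mem_Icc hC hz₀ hx) _ (sub_q_mem_Icc hC hz hx)
    simpa using this)
  have h2 := integral_mono_ae (i2.add (i6.const_mul (C' / 2 : ℝ))) (i9.sub i10) (by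
    filter_upwards [ae_norm_le hν] with x hx
    have := tangent _ (conj_sub_q_mem_Icc hlam hC hz₀ hx) _ (conj_sub_q_mem_Icc hlam hC hz hx)
    simpa using this)
  -- The quadratic gap for z is taken at w = ∇z₀^*(y), then weighted by the nonnegative density of
  -- ν̃.
  have h3 := integral_mono_ae (i4.const_mul (lam / 2)) (i2.sub i3) (by
    filter_upwards [ae_norm_le hν] with y hy
    have h4 := deriv_nonneg hψ hψm (conj_sub_q_mem_Icc hlam hC hz₀ hy)
    have h5 := sq_norm_sub_conjArg_le hlam hs hl (conjArg z₀ y) y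
    rw [norm_sub_rev] at h5
    have h6 := conj_eq hlam hs₀ hl₀ y
    have h7 := mul_le_mul_of_nonneg_left (h5.trans (le_of_eq (by rw [h6]; ring :
      _ = conj z y - conj z₀ y - (z₀ (conjArg z₀ y) - z (conjArg z₀ y))))) h4
    simp only [Pi.sub_apply]
    linarith)
  rw [integral_add' i1 (i5.const_mul _), integral_sub' i7 i8, integral_const_mul] at h1
  rw [integral_add' i2 (i6.const_mul _), integral_sub' i9 i10, integral_const_mul] at h2
  rw [integral_sub' i2 i3, integral_const_mul] at h3
  unfold realSemiDual
  linarith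

end Stability

/-! ### Subgaussian maxima and Hoeffding's inequality for empirical means -/

section Subgaussian

variable {Ω : Type*} [MeasurableSpace Ω] {P : Measure Ω}

/-- The bound W linearizes the log-sum-exp through 1 + u ≤ exp u. The shift s is chosen so that
exp(-s) times the sum of the exponentials has mean at most 1. -/
theorem exists_upper_bound_of_hasSubgaussianMGF_aux [IsProbabilityMeasure P] {ι : Type*}
    {S : Finset ι} (hS : S.Nonempty) {Y : ι → Ω → ℝ} {c : ℝ≥0}
    (hY : ∀ i ∈ S, HasSubgaussianMGF (Y i) c P) {t : ℝ} (ht : 0 < t) :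
    ∃ W : Ω → ℝ, Integrable W P ∧ (∀ i ∈ S, ∀ ω, Y i ω ≤ W ω) ∧
      ∫ ω, W ω ∂P ≤ Real.log S.card / t + c * t / 2 := by
  have hm : (0 : ℝ) < S.card := by exact_mod_cast hS.card_pos
  set s : ℝ := Real.log S.card + c * t ^ 2 / 2 with hs
  have hint : Integrable (fun ω => ∑ i ∈ S, Real.exp (t * Y i ω)) P :=
    integrable_finsetSum _ fun i hi => (hY i hi).integrable_exp_mul t
  refine ⟨fun ω => t⁻¹ * (Real.exp (-s) * (∑ i ∈ S, Real.exp (t * Y i ω)) + (s - 1)),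
    ((hint.const_mul _).add (integrable_const _)).const_mul _, fun i hi ω => ?_, ?_⟩
  · have h1 := Real.add_one_le_exp (t * Y i ω - s)
    have h2 : Real.exp (t * Y i ω) ≤ ∑ i ∈ S, Real.exp (t * Y i ω) :=
      Finset.single_le_sum (f := fun i => Real.exp (t * Y i ω)) (fun j _ => (Real.exp_pos _).le) hi
    have h3 := mul_le_mul_of_nonneg_left h2 (Real.exp_pos (-s)).le
    rw [← Real.exp_add, (by ring : -s + t * Y i ω = t * Y i ω - s)] at h3
    simp only
    rw [← div_eq_inv_mul, le_div_iff₀ ht]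
    linarith
  · rw [integral_const_mul, integral_add (hint.const_mul _) (integrable_const _),
      integral_const_mul, integral_finsetSum _ fun i hi => (hY i hi).integrable_exp_mul t]
    simp only [integral_const, probReal_univ, one_smul]
    have h1 : ∑ i ∈ S, ∫ ω, Real.exp (t * Y i ω) ∂P ≤ S.card * Real.exp (c * t ^ 2 / 2) := by
      rw [← nsmul_eq_mul]
      exact Finset.sum_le_card_nsmul _ _ _ fun i hi => (hY i hi).mgf_le t
    have h2 : Real.exp (-s) * (S.card * Real.exp (c * t ^ 2 / 2)) = 1 := by
      rw [hs, neg_add, Real.exp_add, Real.exp_neg, Real.exp_log hm, Real.exp_neg]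
      have := Real.exp_pos (c * t ^ 2 / 2)
      field_simp
    have h3 := mul_le_mul_of_nonneg_left h1 (Real.exp_pos (-s)).le
    rw [h2] at h3
    calc _ ≤ t⁻¹ * (1 + (s - 1)) := by gcongr
      _ = _ := by rw [hs]; field_simp; ring

/-- A finite family of `c`-subgaussian variables has an upper bound of mean at most
`√(2 c log m)`, where `m` is the number of variables. -/
theorem exists_upper_bound_of_hasSubgaussianMGF [IsProbabilityMeasure P] {ι : Type*}
    {S : Finset ι} (hS : S.Nonempty) {Y : ι → Ω → ℝ} {c : ℝ≥0} (hc : 0 < c)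
    (hY : ∀ i ∈ S, HasSubgaussianMGF (Y i) c P) :
    ∃ W : Ω → ℝ, Integrable W P ∧ (∀ i ∈ S, ∀ ω, Y i ω ≤ W ω) ∧
      ∫ ω, W ω ∂P ≤ √(2 * c * Real.log S.card) := by
  have hc' : (0 : ℝ) < c := hc
  -- For a single variable the logarithm vanishes and the optimal t degenerates to 0: the variable
  -- bounds itself, and its mean is shown to be at most every ε.
  rcases hS.card_pos.nat_succ_le.eq_or_lt with h1 | h1
  · obtain ⟨i, rfl⟩ := Finset.card_eq_one.1 h1.symm
    have hi : HasSubgaussianMGF (Y i) c P := hY i (by simp)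
    refine ⟨Y i, hi.integrable, fun j hj ω => by rw [Finset.mem_singleton.1 hj], ?_⟩
    simp only [Finset.card_singleton, Nat.cast_one, Real.log_one, mul_zero, Real.sqrt_zero]
    refine le_of_forall_pos_le_add fun ε hε => ?_
    obtain ⟨W, hW, hYW, hWi⟩ := exists_upper_bound_of_hasSubgaussianMGF_aux hS hY
      (t := 2 * ε / c) (by positivity)
    refine (integral_mono hi.integrable hW (hYW i (by simp))).trans (hWi.trans (le_of_eq ?_))
    simp only [Finset.card_singleton, Nat.cast_one, Real.log_one, zero_div]
    field_simp
  · have hlog : 0 < Real.log S.card := Real.log_pos (by exact_mod_cast h1)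
    -- This t = √(2 log m / c) minimizes log m / t + c t / 2.
    obtain ⟨W, hW, hYW, hWi⟩ := exists_upper_bound_of_hasSubgaussianMGF_aux hS hY
      (t := √(2 * c * Real.log S.card) / c) (by positivity)
    refine ⟨W, hW, hYW, hWi.trans (le_of_eq ?_)⟩
    set L := Real.log S.card
    have hsq : √(2 * c * L) ^ 2 = 2 * c * L := Real.sq_sqrt (by positivity)
    have hpos : 0 < √(2 * c * L) := Real.sqrt_pos.2 (by positivity)
    rw [div_div_eq_mul_div, mul_div_cancel₀ _ hc'.ne', div_add_div _ _ hpos.ne' two_ne_zero,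
      div_eq_iff (by positivity)]
    linear_combination -hsq

/-- Hoeffding's lemma on [-b, b] gives parameter b² for each centred term; independence adds the n
parameters and the average divides by n². -/
theorem IsSample.hasSubgaussianMGF [IsProbabilityMeasure P] {d n : ℕ} {ρ : Measure (E d)}
    {x : Fin n → Ω → E d} (hx : IsSample P ρ x) (hn : 0 < n) {h : E d → ℝ} (hh : Measurable h)
    {b : ℝ≥0} (hb : ∀ᵐ v ∂ρ, |h v| ≤ b) :
    HasSubgaussianMGF (fun ω => ∫ v, h v ∂ρ - (n : ℝ)⁻¹ * ∑ i, h (x i ω)) (b ^ 2 / n) P := by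
  have hn' : (n : ℝ) ≠ 0 := by positivity
  have h1 : ∀ i ∈ Finset.univ, HasSubgaussianMGF (fun ω => h (x i ω) - ∫ v, h v ∂ρ) (b ^ 2) P := by
    intro i _
    have h2 : ∀ᵐ ω ∂P, h (x i ω) ∈ Icc (-(b : ℝ)) b := by
      have := hb
      rw [← hx.2.1 i] at this
      filter_upwards [ae_of_ae_map (hx.1 i).aemeasurable this] with ω hω
      exact abs_le.1 hω
    have h3 := hasSubgaussianMGF_of_mem_Icc (hh.comp (hx.1 i)).aemeasurable h2
    have h4 : ∫ ω, (h ∘ x i) ω ∂P = ∫ v, h v ∂ρ := by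
      rw [← hx.2.1 i, integral_map (hx.1 i).aemeasurable hh.aestronglyMeasurable]
      rfl
    rw [h4] at h3
    have e : (‖(b : ℝ) - -b‖₊ / 2) ^ 2 = b ^ 2 := by
      rw [← NNReal.coe_inj]
      simp only [NNReal.coe_pow, NNReal.coe_div, coe_nnnorm, NNReal.coe_ofNat, Real.norm_eq_abs,
        sub_neg_eq_add]
      rw [abs_of_nonneg (by positivity)]
      ring
    rwa [e] at h3
  have hind : iIndepFun (fun i ω => h (x i ω) - ∫ v, h v ∂ρ) P :=
    hx.2.2.comp (fun _ v => h v - ∫ v, h v ∂ρ) fun _ => hh.sub_const _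
  have h5 := (HasSubgaussianMGF.sum_of_iIndepFun hind h1).const_mul (-(n : ℝ)⁻¹)
  convert h5 using 1
  · funext ω
    rw [Finset.sum_sub_distrib]
    simp only [Finset.sum_const, Finset.card_univ, Fintype.card_fin, nsmul_eq_mul]
    field_simp
    ring
  · refine NNReal.eq ?_
    change (b : ℝ) ^ 2 / n = (-(n : ℝ)⁻¹) ^ 2 * ((∑ _i : Fin n, b ^ 2 : ℝ≥0) : ℝ)
    simp only [Finset.sum_const, Finset.card_univ, Fintype.card_fin, nsmul_eq_mul,
      NNReal.coe_mul, NNReal.coe_pow, NNReal.coe_natCast]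
    field_simp

end Subgaussian

/-! ### Chaining -/

section Chaining

variable {T : Type*} [PseudoEMetricSpace T] {C : Set T}

/-- The logarithm of the external covering number. -/
def coveringEntropy (C : Set T) (ε : ℝ) : ℝ≥0∞ :=
  (ENNReal.log ((Metric.externalCoveringNumber ε.toNNReal C : ℕ∞) : ℝ≥0∞)).toENNReal

theorem coveringEntropy_antitone (C : Set T) : Antitone (coveringEntropy C) := by
  intro a b hab
  refine EReal.toENNReal_le_toENNReal (ENNReal.log_monotone ?_)
  exact_mod_cast Metric.externalCoveringNumber_anti (Real.toNNReal_le_toNNReal hab)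

theorem coveringEntropy_eq_top {ε : ℝ}
    (h : Metric.externalCoveringNumber ε.toNNReal C = ⊤) : coveringEntropy C ε = ⊤ := by
  simp [coveringEntropy, h]

theorem ofReal_sqrt_log_le {ε : ℝ} {m : ℕ} (hm : 0 < m)
    (h : (m : ℕ∞) ≤ Metric.externalCoveringNumber ε.toNNReal C) :
    ENNReal.ofReal √(Real.log m) ≤ coveringEntropy C ε ^ (1 / 2 : ℝ) := by
  rw [Real.sqrt_eq_rpow, ← ENNReal.ofReal_rpow_of_nonneg (Real.log_natCast_nonneg m) (by norm_num)]
  refine ENNReal.rpow_le_rpow ?_ (by norm_num)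
  have h1 : ENNReal.log (m : ℝ≥0∞) = (Real.log m : EReal) := by
    rw [← ENNReal.ofReal_natCast, ENNReal.log_ofReal_of_pos (by exact_mod_cast hm)]
  have h2 : ENNReal.ofReal (Real.log m) = (ENNReal.log (m : ℝ≥0∞)).toENNReal := by
    rw [h1]
    simp
  rw [h2]
  refine EReal.toENNReal_le_toENNReal (ENNReal.log_monotone ?_)
  exact_mod_cast h

/-- External covers may have centres outside C, where the process is not controlled; moving the
centres into C doubles the radius. -/
theorem exists_finset_net {ε : ℝ≥0} (h : Metric.externalCoveringNumber ε C ≠ ⊤) :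
    ∃ S : Finset T, (∀ s ∈ S, s ∈ C) ∧ (S.card : ℕ∞) ≤ Metric.externalCoveringNumber ε C ∧
      ∀ t ∈ C, ∃ s ∈ S, edist t s ≤ (2 * ε : ℝ≥0) := by
  have h1 := Metric.coveringNumber_two_mul_le_externalCoveringNumber ε C
  have h2 : Metric.coveringNumber (2 * ε) C ≠ ⊤ := ne_top_of_le_ne_top h h1
  have h3 := Metric.encard_minimalCover h2
  have hfin : (Metric.minimalCover (2 * ε) C).Finite := by
    rw [← Set.encard_ne_top_iff, h3]
    exact h2
  refine ⟨hfin.toFinset, fun s hs => Metric.minimalCover_subset (hfin.mem_toFinset.1 hs), ?_,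
    fun t ht => ?_⟩
  · rw [← hfin.encard_eq_coe_toFinset_card, h3]
    exact h1
  · obtain ⟨s, hs, hst⟩ := Metric.isCover_minimalCover h2 ht
    exact ⟨s, hfin.mem_toFinset.2 hs, hst⟩

variable {Ω : Type*} [MeasurableSpace Ω] {P : Measure Ω}

/-- Induction on the scale: each point of the finer net is linked to a nearby point of the previous
one, so only as many increments as the finer net has points need be bounded. Their upper bounds W
are summed, which avoids measurability of suprema. -/
theorem chaining_finite_scale [IsProbabilityMeasure P] {t₀ : T} (ht₀ : t₀ ∈ C) {Z : T → Ω → ℝ}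
    {D σ : ℝ≥0} (hD : ∀ t ∈ C, edist t t₀ ≤ D) (hDpos : 0 < D) (hσ : 0 < σ)
    (hsub : ∀ s ∈ C, ∀ t ∈ C, ∀ ε : ℝ≥0, edist t s ≤ ε →
      HasSubgaussianMGF (fun ω => Z t ω - Z s ω) ((σ * ε) ^ 2) P) (k : ℕ)
    (hk : Metric.externalCoveringNumber (D / 2 ^ k) C ≠ ⊤) :
    ∃ S : Finset T, (∀ s ∈ S, s ∈ C) ∧
      (∀ t ∈ C, ∃ s ∈ S, edist t s ≤ (2 * (D / 2 ^ k) : ℝ≥0)) ∧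
      ∃ W : Ω → ℝ, Integrable W P ∧ (∀ s ∈ S, ∀ ω, Z s ω - Z t₀ ω ≤ W ω) ∧
        ENNReal.ofReal (∫ ω, W ω ∂P) ≤ ENNReal.ofReal (12 * σ) *
          ∫⁻ u in Ioc ((D : ℝ) / 2 ^ (k + 1)) D, coveringEntropy C u ^ (1 / 2 : ℝ) := by
  induction k with
  | zero =>
    refine ⟨{t₀}, by simpa using ht₀, fun t ht => ⟨t₀, by simp, (hD t ht).trans ?_⟩, 0,
      integrable_zero _ _ _, by simp, by simp⟩
    rw [ENNReal.coe_le_coe, pow_zero, div_one]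
    exact le_mul_of_one_le_left D.2 (by norm_num)
  | succ k ih =>
    have hle : D / 2 ^ (k + 1) ≤ D / 2 ^ k := by
      gcongr
      · norm_num
      · omega
    obtain ⟨S, hSC, hS, W, hW, hSW, hWi⟩ :=
      ih (ne_top_of_le_ne_top hk (Metric.externalCoveringNumber_anti hle))
    obtain ⟨S', hSC', hcard, hS'⟩ := exists_finset_net hk
    have hne : S'.Nonempty := by
      obtain ⟨s, hs, -⟩ := hS' t₀ ht₀
      exact ⟨s, hs⟩
    choose! p hpS hp using hS
    set e : ℝ≥0 := D / 2 ^ (k + 1) with he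
    have heD : 2 * (D / 2 ^ k) = 4 * e := by
      rw [he, pow_succ]
      field_simp
      norm_num
    rw [heD] at hp
    obtain ⟨W', hW', hSW', hWi'⟩ := exists_upper_bound_of_hasSubgaussianMGF hne
      (Y := fun t ω => Z t ω - Z (p t) ω) (c := (σ * (4 * e)) ^ 2) (by positivity)
      fun t ht => hsub _ (hSC _ (hpS t (hSC' t ht))) t (hSC' t ht) _ (hp t (hSC' t ht))
    refine ⟨S', hSC', hS', fun ω => W ω + W' ω, hW.add hW', fun s hs ω => ?_, ?_⟩
    · have h1 := hSW' s hs ω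
      have h2 := hSW _ (hpS s (hSC' s hs)) ω
      linarith
    rw [integral_add hW hW']
    refine ENNReal.ofReal_add_le.trans ?_
    have he_real : ((D : ℝ) / 2 ^ (k + 1)) = e := by rw [he]; push_cast; rfl
    have he_real' : ((D : ℝ) / 2 ^ (k + 1 + 1)) = e / 2 := by
      rw [← he_real, pow_succ _ (k + 1)]
      field_simp
    have he0 : (0 : ℝ) ≤ e := e.2
    have heD' : (e : ℝ) ≤ D := by
      rw [← he_real]
      exact div_le_self D.2 (one_le_pow₀ (by norm_num))
    rw [he_real']
    rw [he_real] at hWi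
    have hun : Ioc ((e : ℝ) / 2) D = Ioc ((e : ℝ) / 2) e ∪ Ioc (e : ℝ) D :=
      (Ioc_union_Ioc_eq_Ioc (by linarith) heD').symm
    rw [hun, lintegral_union measurableSet_Ioc (Ioc_disjoint_Ioc_of_le le_rfl), mul_add, add_comm]
    refine add_le_add ?_ hWi
    -- The links have length at most 4e, and √(2·16) ≤ 6 = 12/2. The factor e/2 is the length of
    -- (e/2, e], on which the entropy is at least its value at e.
    have h1 : √(2 * ((σ * (4 * e)) ^ 2 : ℝ≥0) * Real.log S'.card) ≤
        12 * σ * (e / 2) * √(Real.log S'.card) := by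
      refine Real.sqrt_le_left (by positivity) |>.2 ?_
      rw [mul_pow (12 * (σ : ℝ) * (e / 2)), Real.sq_sqrt (Real.log_natCast_nonneg _)]
      refine mul_le_mul_of_nonneg_right ?_ (Real.log_natCast_nonneg _)
      push_cast
      nlinarith [sq_nonneg ((σ : ℝ) * e)]
    have h2 : ENNReal.ofReal √(Real.log S'.card) ≤ coveringEntropy C e ^ (1 / 2 : ℝ) :=
      ofReal_sqrt_log_le hne.card_pos (by rwa [Real.toNNReal_coe])
    calc ENNReal.ofReal (∫ ω, W' ω ∂P)
        ≤ ENNReal.ofReal (12 * σ * (e / 2) * √(Real.log S'.card)) :=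
          ENNReal.ofReal_le_ofReal (hWi'.trans h1)
      _ = ENNReal.ofReal (12 * σ) *
          (ENNReal.ofReal √(Real.log S'.card) * ENNReal.ofReal (e / 2)) := by
          rw [ENNReal.ofReal_mul (by positivity), ENNReal.ofReal_mul (by positivity), mul_assoc,
            mul_comm (ENNReal.ofReal (e / 2 : ℝ))]
      _ ≤ ENNReal.ofReal (12 * σ) *
          ∫⁻ _u in Ioc ((e : ℝ) / 2) e, coveringEntropy C e ^ (1 / 2 : ℝ) := by
          rw [setLIntegral_const, Real.volume_Ioc, (by ring : (e : ℝ) - e / 2 = e / 2)]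
          gcongr
      _ ≤ _ := by
          gcongr ENNReal.ofReal (12 * σ) * ?_
          refine setLIntegral_mono' measurableSet_Ioc fun u hu => ?_
          exact ENNReal.rpow_le_rpow (coveringEntropy_antitone C hu.2) (by norm_num)

/-- Dudley's entropy bound for a process with subgaussian and Lipschitz increments. -/
theorem dudley_bound [IsProbabilityMeasure P] {t₀ : T} (ht₀ : t₀ ∈ C) {Z : T → Ω → ℝ}
    {D σ B : ℝ≥0} (hD : ∀ t ∈ C, edist t t₀ ≤ D) (hDpos : 0 < D) (hσ : 0 < σ)
    (hsub : ∀ s ∈ C, ∀ t ∈ C, ∀ ε : ℝ≥0, edist t s ≤ ε →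
      HasSubgaussianMGF (fun ω => Z t ω - Z s ω) ((σ * ε) ^ 2) P)
    (hlip : ∀ᵐ ω ∂P, ∀ s ∈ C, ∀ t ∈ C, ∀ ε : ℝ≥0, edist t s ≤ ε → Z t ω - Z s ω ≤ B * ε)
    {F : Ω → ℝ} (hF : ∀ᵐ ω ∂P, ∃ t ∈ C, F ω ≤ Z t ω - Z t₀ ω) {δ : ℝ} (hδ : 0 ≤ δ)
    (hδD : δ ≤ D) :
    ∫⁻ ω, ENNReal.ofReal (F ω) ∂P ≤ ENNReal.ofReal (2 * B * δ) + ENNReal.ofReal (12 * σ) *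
      ∫⁻ u in Icc (δ / 4) D, coveringEntropy C u ^ (1 / 2 : ℝ) := by
  have pos : ∀ δ : ℝ, 0 < δ → δ ≤ D →
      ∫⁻ ω, ENNReal.ofReal (F ω) ∂P ≤ ENNReal.ofReal (2 * B * δ) + ENNReal.ofReal (12 * σ) *
        ∫⁻ u in Icc (δ / 4) D, coveringEntropy C u ^ (1 / 2 : ℝ) := by
    intro δ hδ hδD
    have hDr : (0 : ℝ) < D := hDpos
    -- Taking the least k with D/2^k ≤ δ also gives D/2^(k+1) ≥ δ/4, hence the lower limit of the
    -- integral.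
    obtain ⟨k, hk1, hk2⟩ : ∃ k : ℕ, (D : ℝ) / 2 ^ k ≤ δ ∧ δ / 4 ≤ (D : ℝ) / 2 ^ (k + 1) := by
      have hex : ∃ k : ℕ, (D : ℝ) / 2 ^ k ≤ δ := by
        obtain ⟨k, hk⟩ := exists_pow_lt_of_lt_one (div_pos hδ hDr) (by norm_num : (1 / 2 : ℝ) < 1)
        refine ⟨k, ?_⟩
        rw [one_div, inv_pow, lt_div_iff₀ hDr] at hk
        rw [div_eq_inv_mul]
        exact hk.le
      classical
      refine ⟨Nat.find hex, Nat.find_spec hex, ?_⟩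
      rcases hn : Nat.find hex with _ | j
      · norm_num
        linarith
      · have h1 := Nat.find_min hex (m := j) (by omega)
        rw [not_le] at h1
        have h2 : (D : ℝ) / 2 ^ (j + 1 + 1) = D / 2 ^ j / 4 := by
          rw [pow_succ, pow_succ]
          field_simp
          norm_num
        rw [h2]
        linarith
    have hsubset : Ioc ((D : ℝ) / 2 ^ (k + 1)) D ⊆ Icc (δ / 4) D :=
      fun u hu => ⟨hk2.trans hu.1.le, hu.2⟩
    set e : ℝ≥0 := D / 2 ^ k with he
    have he_real : ((D : ℝ) / 2 ^ k) = e := by rw [he]; push_cast; rfl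
    have he_pos : (0 : ℝ) < e := by rw [← he_real]; positivity
    have he_real' : ((D : ℝ) / 2 ^ (k + 1)) = e / 2 := by
      rw [← he_real, pow_succ]
      field_simp
    -- An infinite covering number at scale e makes the entropy infinite on (e/2, e], and the
    -- right-hand side with it.
    by_cases hcov : Metric.externalCoveringNumber e C = ⊤
    · have h1 : ∫⁻ u in Icc (δ / 4) D, coveringEntropy C u ^ (1 / 2 : ℝ) = ⊤ := by
        rw [eq_top_iff]
        have heD : (e : ℝ) ≤ D := by linarith
        calc ⊤ = ∫⁻ _u in Ioc ((e : ℝ) / 2) e, (⊤ : ℝ≥0∞) := by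
              rw [setLIntegral_const, Real.volume_Ioc, ENNReal.top_mul]
              simp only [ne_eq, ENNReal.ofReal_eq_zero, not_le]
              linarith
          _ ≤ ∫⁻ u in Ioc ((e : ℝ) / 2) e, coveringEntropy C u ^ (1 / 2 : ℝ) := by
              refine setLIntegral_mono' measurableSet_Ioc fun u hu => ?_
              have h2 : coveringEntropy C (e : ℝ) = ⊤ :=
                coveringEntropy_eq_top (by rwa [Real.toNNReal_coe])
              have h3 : coveringEntropy C u = ⊤ :=
                eq_top_iff.2 (h2 ▸ coveringEntropy_antitone C hu.2)
              rw [h3, ENNReal.top_rpow_of_pos (by norm_num)]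
          _ ≤ _ := lintegral_mono_set fun u hu => hsubset
              ⟨by rw [he_real']; exact hu.1, hu.2.trans heD⟩
      rw [h1, ENNReal.mul_top (by simpa using hσ.ne'), add_top]
      exact le_top
    · obtain ⟨S, hSC, hS, W, hW, hSW, hWi⟩ :=
        chaining_finite_scale ht₀ hD hDpos hσ hsub k hcov
      have key : ∀ᵐ ω ∂P, ∀ t ∈ C, Z t ω - Z t₀ ω ≤ W ω + 2 * B * e := by
        filter_upwards [hlip] with ω hω t ht
        obtain ⟨s, hs, hst⟩ := hS t ht
        have h1 := hω s (hSC s hs) t ht _ hst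
        have h2 := hSW s hs ω
        push_cast at h1
        rw [he_real] at h1
        linarith
      calc ∫⁻ ω, ENNReal.ofReal (F ω) ∂P
          ≤ ∫⁻ ω, ENNReal.ofReal (W ω + 2 * B * e) ∂P := by
            refine lintegral_mono_ae ?_
            filter_upwards [key, hF] with ω h1 ⟨t, ht, h2⟩
            exact ENNReal.ofReal_le_ofReal (h2.trans (h1 t ht))
        _ = ENNReal.ofReal (∫ ω, (W ω + 2 * B * e) ∂P) := by
            refine (ofReal_integral_eq_lintegral_ofReal (hW.add (integrable_const _)) ?_).symm
            filter_upwards [key] with ω h1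
            simpa using h1 t₀ ht₀
        _ ≤ ENNReal.ofReal (∫ ω, W ω ∂P) + ENNReal.ofReal (2 * B * e) := by
            rw [integral_add hW (integrable_const _)]
            simp only [integral_const, probReal_univ, one_smul]
            exact ENNReal.ofReal_add_le
        _ ≤ _ := by
            rw [add_comm]
            refine add_le_add (ENNReal.ofReal_le_ofReal ?_) (hWi.trans ?_)
            · rw [← he_real]
              gcongr
            · gcongr
  rcases hδ.eq_or_lt with rfl | hδ
  · rw [mul_zero, ENNReal.ofReal_zero, zero_add, zero_div]
    -- For δ = 0 the bound is applied at a small η, whose linear term is at most ε.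
    refine ENNReal.le_of_forall_pos_le_add fun ε hε _ => ?_
    have hDr : (0 : ℝ) < D := hDpos
    have hεr : (0 : ℝ) < ε := hε
    have hB : (0 : ℝ) < 2 * B + 1 := by positivity
    set η : ℝ := min D (ε / (2 * B + 1)) with hη
    have hη0 : 0 < η := lt_min hDr (by positivity)
    refine (pos η hη0 (min_le_left _ _)).trans ?_
    rw [add_comm]
    refine add_le_add ?_ ?_
    · gcongr
      positivity
    · rw [← ENNReal.ofReal_coe_nnreal]
      refine ENNReal.ofReal_le_ofReal ?_
      have h1 : η * (2 * B + 1) ≤ ε := (le_div_iff₀ hB).1 (min_le_right _ _)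
      linarith
  · exact pos δ hδ hδD

end Chaining

/-! ### The empirical semi-dual functional -/

section Final

variable {d n : ℕ} {φ : ℝ≥0 → ℝ≥0∞} {ψ : ℝ → ℝ} {Λ : ℝ≥0} {R R' l lam : ℝ} {M : ℝ → ℝ}
  {μ ν ρ : Measure (E d)} {C : Set (E d → ℝ)} {z z' z₀ : E d → ℝ} {C' : ℝ≥0}

/-- For continuous functions an almost everywhere bound holds on the open ball, because nonempty
open sets have positive volume, and then on its closure. -/
theorem abs_sub_le_of_edist_le {r : ℝ} (hr : 0 < r) (hz : Continuous z) (hz' : Continuous z')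
    {ε : ℝ≥0} (h : (linftyBall d r).edist z z' ≤ ε) {x : E d} (hx : ‖x‖ ≤ r) :
    |z x - z' x| ≤ ε := by
  have h1 : ∀ᵐ x ∂(volume.restrict (Metric.closedBall (0 : E d) r)), ‖(z - z') x‖ₑ ≤ ε := by
    have h2 : eLpNormEssSup (z - z') (volume.restrict (Metric.closedBall (0 : E d) r)) ≤ ε := by
      rw [← eLpNorm_exponent_top]
      exact h
    filter_upwards [enorm_ae_le_eLpNormEssSup (z - z')
      (volume.restrict (Metric.closedBall (0 : E d) r))] with x hx
    exact hx.trans h2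
  rw [ae_restrict_iff' Metric.isClosed_closedBall.measurableSet] at h1
  have hcl : IsClosed {x : E d | |z x - z' x| ≤ ε} :=
    isClosed_le (by fun_prop) continuous_const
  have hsub : Metric.ball (0 : E d) r ⊆ {x : E d | |z x - z' x| ≤ ε} := by
    have hopen : IsOpen (Metric.ball (0 : E d) r ∩ {x : E d | |z x - z' x| ≤ ε}ᶜ) :=
      Metric.isOpen_ball.inter hcl.isOpen_compl
    have h3 : volume (Metric.ball (0 : E d) r ∩ {x : E d | |z x - z' x| ≤ ε}ᶜ) = 0 := by
      rw [measure_eq_zero_iff_ae_notMem]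
      filter_upwards [h1] with x hx hx'
      refine hx'.2 ?_
      have := hx (Metric.ball_subset_closedBall hx'.1)
      rw [enorm_le_coe, ← NNReal.coe_le_coe] at this
      simpa using this
    have h4 := hopen.eq_empty_of_measure_zero h3
    intro x hx
    by_contra hx'
    have : x ∈ (∅ : Set (E d)) := h4 ▸ ⟨hx, hx'⟩
    exact this
  have h5 : closure (Metric.ball (0 : E d) r) ⊆ {x : E d | |z x - z' x| ≤ ε} :=
    hcl.closure_subset_iff.2 hsub
  rw [closure_ball _ hr.ne'] at h5
  exact h5 (by simpa using hx)

theorem edist_le_of_abs_sub_le {r : ℝ} {ε : ℝ≥0} (h : ∀ x : E d, ‖x‖ ≤ r → |z x - z' x| ≤ ε) :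
    (linftyBall d r).edist z z' ≤ ε := by
  change eLpNorm (z - z') ∞ (volume.restrict (Metric.closedBall 0 r)) ≤ ε
  rw [eLpNorm_exponent_top]
  refine eLpNormEssSup_le_of_ae_enorm_bound ?_
  filter_upwards [ae_restrict_mem Metric.isClosed_closedBall.measurableSet] with x hx
  rw [enorm_le_coe, ← NNReal.coe_le_coe]
  simpa using h x (by simpa using hx)

theorem lintegral_enorm_sq_eq {F : Type*} [NormedAddCommGroup F] [IsFiniteMeasure ρ]
    (hρ : ρ (Metric.closedBall 0 R)ᶜ = 0) {f : E d → F} (hf : Continuous f) :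
    ∫⁻ x, ‖f x‖ₑ ^ 2 ∂ρ = ENNReal.ofReal (∫ x, ‖f x‖ ^ 2 ∂ρ) := by
  rw [ofReal_integral_eq_lintegral_ofReal (integrable_of_continuous hρ (by fun_prop))
    (Eventually.of_forall fun x => by positivity)]
  congr 1 with x
  rw [ENNReal.ofReal_pow (norm_nonneg _), ofReal_norm]

/-- Passing from λ/2 to 1/(2λ) costs 1/λ², and from C'/2 to C' costs 2; the sum of the two factors
serves both terms. -/
theorem IsPotential.distSq_le [IsFiniteMeasure μ] [IsFiniteMeasure ν]
    (hμ : μ (Metric.closedBall 0 R)ᶜ = 0) (hν : ν (Metric.closedBall 0 R)ᶜ = 0)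
    (hlam : 0 < lam) (hC : BoundedStronglyConvex M l lam C) (hz₀ : z₀ ∈ C) (hz : z ∈ C)
    (hψ : IsConjExtension φ (argBound M R l lam) ψ) (hψm : Monotone ψ) (hψl : LipschitzWith Λ ψ)
    (hC' : StrongConvexOn (Icc (-argBound M R l lam) (argBound M R l lam)) (C' : ℝ)
      (entropyConjReal φ))
    {X Y : Set (E d)} (h : IsPotential φ X Y μ ν z₀) :
    distSq φ lam C' μ ν z₀ z z₀ ≤ ENNReal.ofReal (1 / lam ^ 2 + 2) *
      ENNReal.ofReal (realSemiDual ψ μ ν z - realSemiDual ψ μ ν z₀) := by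
  have hstab := h.stability hμ hν hlam hC hz₀ hz hψ hψm hψl hC'
  obtain ⟨-, hl, hs⟩ := hC z hz
  obtain ⟨-, hl₀, hs₀⟩ := hC z₀ hz₀
  have hzc := continuous_of_strongConvexOn hlam hs
  have hzc₀ := continuous_of_strongConvexOn hlam hs₀
  have hac := continuous_conjArg hlam hs hl
  have hac₀ := continuous_conjArg hlam hs₀ hl₀
  have hcc := continuous_conj hlam hs hl
  have hcc₀ := continuous_conj hlam hs₀ hl₀
  have hgm : Measurable fun y => deriv (entropyConjReal φ) (conj z₀ y - q y) :=
    (measurable_deriv _).comp (hcc₀.sub continuous_q).measurable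
  have hg : ∀ᵐ y ∂ν, 0 ≤ deriv (entropyConjReal φ) (conj z₀ y - q y) := by
    filter_upwards [ae_norm_le hν] with y hy
    exact deriv_nonneg hψ hψm (conj_sub_q_mem_Icc hlam hC hz₀ hy)
  have i4 := integrable_deriv_mul (b := fun y => ‖conjArg z y - conjArg z₀ y‖ ^ 2) hν hψ hψl
    (hcc₀.sub continuous_q) (fun x hx => conj_sub_q_mem_Icc hlam hC hz₀ hx) (by fun_prop)
  simp only [Pi.sub_apply] at i4
  have hg2 : ∀ᵐ y ∂ν, 0 ≤ deriv (entropyConjReal φ) (conj z₀ y - q y) *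
      ‖conjArg z y - conjArg z₀ y‖ ^ 2 := by
    filter_upwards [hg] with y hy
    positivity
  have e1 : ∫⁻ y, ‖gradient (fun w => conj z w - conj z₀ w) y‖ₑ ^ 2 ∂(tiltedMeasure φ ν z₀) =
      ENNReal.ofReal (∫ y, deriv (entropyConjReal φ) (conj z₀ y - q y) *
        ‖conjArg z y - conjArg z₀ y‖ ^ 2 ∂ν) := by
    simp_rw [gradient_conj_sub_conj hlam hs hl hs₀ hl₀]
    rw [tiltedMeasure, lintegral_withDensity_eq_lintegral_mul _ hgm.ennreal_ofReal
      (by fun_prop : Measurable fun y => ‖conjArg z y - conjArg z₀ y‖ₑ ^ 2),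
      ofReal_integral_eq_lintegral_ofReal i4 hg2]
    refine lintegral_congr_ae ?_
    filter_upwards [hg] with y hy
    rw [Pi.mul_apply, ENNReal.ofReal_mul hy, ENNReal.ofReal_pow (norm_nonneg _), ofReal_norm]
  rw [distSq, e1, lintegral_enorm_sq_eq hν (by fun_prop), lintegral_enorm_sq_eq hμ (by fun_prop)]
  simp only [Real.norm_eq_abs, sq_abs]
  have p1 := integral_nonneg_of_ae hg2
  have p2 : 0 ≤ ∫ y, (conj z y - conj z₀ y) ^ 2 ∂ν := integral_nonneg fun y => sq_nonneg _
  have p3 : 0 ≤ ∫ x, (z x - z₀ x) ^ 2 ∂μ := integral_nonneg fun y => sq_nonneg _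
  set A := ∫ y, deriv (entropyConjReal φ) (conj z₀ y - q y) *
        ‖conjArg z y - conjArg z₀ y‖ ^ 2 ∂ν
  set B₁ := ∫ y, (conj z y - conj z₀ y) ^ 2 ∂ν
  set B₂ := ∫ x, (z x - z₀ x) ^ 2 ∂μ
  have hC'0 : (0 : ℝ) ≤ C' := C'.2
  rw [← ENNReal.ofReal_add p2 p3, ← ENNReal.ofReal_coe_nnreal, ← ENNReal.ofReal_mul hC'0,
    ← ENNReal.ofReal_mul (by positivity), ← ENNReal.ofReal_add (by positivity) (by positivity),
    ← ENNReal.ofReal_mul (by positivity)]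
  refine ENNReal.ofReal_le_ofReal (le_trans ?_ (mul_le_mul_of_nonneg_left hstab (by positivity)))
  have e2 : (1 / lam ^ 2 + 2) * (lam / 2 * A + C' / 2 * (B₁ + B₂)) =
      1 / (2 * lam) * A + C' * (B₁ + B₂) + (lam * A + 1 / lam ^ 2 * (C' / 2 * (B₁ + B₂))) := by
    field_simp
    ring
  rw [e2]
  have : 0 ≤ lam * A + 1 / lam ^ 2 * (C' / 2 * (B₁ + B₂)) := by positivity
  linarith

theorem integral_empirical (x : Fin n → E d) (f : E d → ℝ) :
    ∫ v, f v ∂(empirical x) = (n : ℝ)⁻¹ * ∑ i, f (x i) := by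
  rw [empirical, integral_smul_measure, integral_finsetSum_measure]
  · simp [integral_dirac]
  · exact fun i _ => integrable_dirac (by simp)

theorem isFiniteMeasure_empirical (hn : 0 < n) (x : Fin n → E d) :
    IsFiniteMeasure (empirical x) := by
  refine ⟨?_⟩
  rw [empirical, Measure.smul_apply, smul_eq_mul]
  refine ENNReal.mul_lt_top ?_ (measure_lt_top _ _)
  simpa [ENNReal.inv_lt_top] using hn

theorem empirical_compl_closedBall {x : Fin n → E d} (hx : ∀ i, ‖x i‖ ≤ R) :
    empirical x (Metric.closedBall 0 R)ᶜ = 0 := by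
  have h : ∀ i, Measure.dirac (x i) (Metric.closedBall 0 R)ᶜ = 0 := fun i => by
    rw [Measure.dirac_apply' _ Metric.isClosed_closedBall.measurableSet.compl]
    simpa using hx i
  simp [empirical, h]

theorem IsSample.ae_norm_le {Ω : Type*} [MeasurableSpace Ω] {P : Measure Ω}
    {x : Fin n → Ω → E d} (hx : IsSample P ρ x) (hρ : ρ (Metric.closedBall 0 R)ᶜ = 0) :
    ∀ᵐ ω ∂P, ∀ i, ‖x i ω‖ ≤ R := by
  refine ae_all_iff.2 fun i => ?_
  have := UOT.ae_norm_le hρ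
  rw [← hx.2.1 i] at this
  exact ae_of_ae_map (hx.1 i).aemeasurable this

/-- The centred empirical process indexed by functions. -/
def empiricalGap {Ω : Type*} (ρ : Measure (E d)) (x : Fin n → Ω → E d) (h : E d → ℝ) (ω : Ω) : ℝ :=
  ∫ v, h v ∂ρ - (n : ℝ)⁻¹ * ∑ i, h (x i ω)

theorem empiricalGap_sub {Ω : Type*} [IsFiniteMeasure ρ] (hρ : ρ (Metric.closedBall 0 R)ᶜ = 0)
    (x : Fin n → Ω → E d) {f g : E d → ℝ} (hf : Continuous f) (hg : Continuous g) (ω : Ω) :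
    empiricalGap ρ x f ω - empiricalGap ρ x g ω = empiricalGap ρ x (fun v => f v - g v) ω := by
  unfold empiricalGap
  rw [integral_sub (integrable_of_continuous hρ hf) (integrable_of_continuous hρ hg),
    Finset.sum_sub_distrib]
  ring

theorem empiricalGap_le {Ω : Type*} [IsProbabilityMeasure ρ]
    (hρ : ρ (Metric.closedBall 0 R)ᶜ = 0) (hn : 0 < n) {x : Fin n → Ω → E d} {ω : Ω}
    (hx : ∀ i, ‖x i ω‖ ≤ R) {h : E d → ℝ} (hh : Continuous h) {b : ℝ}
    (hb : ∀ v : E d, ‖v‖ ≤ R → |h v| ≤ b) : empiricalGap ρ x h ω ≤ 2 * b := by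
  have hn' : (n : ℝ) ≠ 0 := by positivity
  have h1 : ∫ v, h v ∂ρ ≤ b := by
    have := integral_mono_ae (integrable_of_continuous hρ hh) (integrable_const b) (by
      filter_upwards [ae_norm_le hρ] with v hv
      exact (abs_le.1 (hb v hv)).2)
    simpa using this
  have h2 : (n : ℝ)⁻¹ * ∑ _i : Fin n, (-b) ≤ (n : ℝ)⁻¹ * ∑ i, h (x i ω) := by
    gcongr with i
    exact (abs_le.1 (hb _ (hx i))).1
  rw [Finset.sum_const, Finset.card_univ, Fintype.card_fin, nsmul_eq_mul,
    inv_mul_cancel_left₀ hn'] at h2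
  unfold empiricalGap
  linarith

/-- The difference of the semi-dual functional and its empirical version. -/
def semiDualGap {Ω : Type*} (ψ : ℝ → ℝ) (μ ν : Measure (E d)) (x y : Fin n → Ω → E d)
    (z : E d → ℝ) (ω : Ω) : ℝ :=
  empiricalGap μ x (fun v => ψ (z v - q v)) ω + empiricalGap ν y (fun v => ψ (conj z v - q v)) ω

theorem semiDualGap_eq {Ω : Type*} (ψ : ℝ → ℝ) (μ ν : Measure (E d)) (x y : Fin n → Ω → E d)
    (z : E d → ℝ) (ω : Ω) : semiDualGap ψ μ ν x y z ω = realSemiDual ψ μ ν z -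
      realSemiDual ψ (empirical fun i => x i ω) (empirical fun i => y i ω) z := by
  unfold semiDualGap realSemiDual empiricalGap
  rw [integral_empirical, integral_empirical]
  ring

theorem abs_comp_sub_le (hψl : LipschitzWith Λ ψ) {a b c ε : ℝ} (h : |a - b| ≤ ε) :
    |ψ (a - c) - ψ (b - c)| ≤ Λ * ε := by
  have h1 := hψl.dist_le_mul (a - c) (b - c)
  rw [Real.dist_eq, Real.dist_eq, sub_sub_sub_cancel_right] at h1
  exact h1.trans (by gcongr)

theorem abs_increments_le (hR' : 0 < R') (hRR' : R ≤ R') (hGR' : gradBound M l lam R ≤ R')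
    (hlam : 0 < lam) (hC : BoundedStronglyConvex M l lam C) (hz : z ∈ C) (hz' : z' ∈ C)
    (hψl : LipschitzWith Λ ψ) {ε : ℝ≥0} (h : (linftyBall d R').edist z z' ≤ ε) {v : E d}
    (hv : ‖v‖ ≤ R) : |ψ (z v - q v) - ψ (z' v - q v)| ≤ Λ * ε ∧
      |ψ (conj z v - q v) - ψ (conj z' v - q v)| ≤ Λ * ε := by
  have hzc := continuous_of_strongConvexOn hlam (hC z hz).2.2
  have hzc' := continuous_of_strongConvexOn hlam (hC z' hz').2.2
  have h1 : ∀ x : E d, ‖x‖ ≤ R' → |z x - z' x| ≤ ε := fun x hx =>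
    abs_sub_le_of_edist_le hR' hzc hzc' h hx
  exact ⟨abs_comp_sub_le hψl (h1 v (hv.trans hRR')), abs_comp_sub_le hψl
    (conj_sub_conj_le hlam hC hz hz' (fun x hx => h1 x (hx.trans hGR')) hv)⟩

theorem setLIntegral_comp_mul_left {L : ℝ} (hL : 0 < L) (f : ℝ → ℝ≥0∞) (a b : ℝ) :
    ∫⁻ w in Icc (L * a) (L * b), f w = ENNReal.ofReal L * ∫⁻ u in Icc a b, f (L * u) := by
  have h1 := Real.smul_map_volume_mul_left hL.ne'
  rw [abs_of_pos hL] at h1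
  have hemb : MeasurableEmbedding (L * ·) := (Homeomorph.mulLeft₀ L hL.ne').measurableEmbedding
  have h2 : (L * ·) ⁻¹' Icc (L * a) (L * b) = Icc a b := by
    ext u
    simp [hL, mul_div_cancel_left₀ _ hL.ne']
  rw [← h1, Measure.restrict_smul, lintegral_smul_measure, hemb.restrict_map, hemb.lintegral_map,
    h2, h1, smul_eq_mul]

end Final

/-! ### The excess of the empirical minimizer -/

section Main

variable {d n : ℕ} {φ : ℝ≥0 → ℝ≥0∞} {ψ : ℝ → ℝ} {Λ : ℝ≥0} {R R' l lam : ℝ} {M : ℝ → ℝ}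
  {μ ν : Measure (E d)} {C : Set (E d → ℝ)} {z₀ : E d → ℝ}

theorem argBound_nonneg [IsProbabilityMeasure μ] (hμ : μ (Metric.closedBall 0 R)ᶜ = 0)
    (hC : BoundedStronglyConvex M l lam C) (hz₀ : z₀ ∈ C) : 0 ≤ argBound M R l lam := by
  obtain ⟨x, hx⟩ := (ae_norm_le hμ).exists
  have h1 := (abs_nonneg _).trans ((hC z₀ hz₀).1 R x hx)
  exact le_trans (by positivity) (le_max_left _ _)

/-- Dudley's bound is applied to J - Ĵ, whose increments dominate the excess of the minimizer. -/
theorem lintegral_excess_le {Ω : Type*} [MeasurableSpace Ω] {P : Measure Ω} [IsProbabilityMeasure P]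
    [IsProbabilityMeasure μ] [IsProbabilityMeasure ν]
    (hR' : 0 < R') (hRR' : R ≤ R') (hGR' : gradBound M l lam R ≤ R')
    (hμ : μ (Metric.closedBall 0 R)ᶜ = 0) (hν : ν (Metric.closedBall 0 R)ᶜ = 0)
    (hlam : 0 < lam) (hC : BoundedStronglyConvex M l lam C) (hz₀ : z₀ ∈ C)
    (hψ : IsConjExtension φ (argBound M R l lam) ψ) (hψl : LipschitzWith Λ ψ) (hΛ : 0 < Λ)
    (hn : 0 < n) {x y : Fin n → Ω → E d} (hx : IsSample P μ x) (hy : IsSample P ν y)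
    {zhat : Ω → E d → ℝ}
    (hzhat : ∀ᵐ ω ∂P, zhat ω ∈ C ∧ ∀ z ∈ C,
      semiDual φ (empirical fun i => x i ω) (empirical fun i => y i ω) (zhat ω) ≤
        semiDual φ (empirical fun i => x i ω) (empirical fun i => y i ω) z)
    {D : ℝ≥0} (hD : 2 * M R' ≤ D) (hDpos : 0 < D) {δ : ℝ} (hδ : 0 ≤ δ) (hδD : δ ≤ D) :
    ∫⁻ ω, ENNReal.ofReal (realSemiDual ψ μ ν (zhat ω) - realSemiDual ψ μ ν z₀) ∂P ≤
      ENNReal.ofReal (8 * Λ * δ) + ENNReal.ofReal (24 * Λ / √n) *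
        ∫⁻ u in Icc (δ / 4) D, metricEntropy C R' u ^ (1 / 2 : ℝ) := by
  let _ : PseudoEMetricSpace (E d → ℝ) := linftyBall d R'
  have hψc := hψl.continuous
  have hxR := hx.ae_norm_le hμ
  have hyR := hy.ae_norm_le hν
  have hq := continuous_q (d := d)
  have hzc : ∀ z ∈ C, Continuous fun v => ψ (z v - q v) := fun z hz => by
    have := continuous_of_strongConvexOn hlam (hC z hz).2.2
    fun_prop
  have hcc : ∀ z ∈ C, Continuous fun v => ψ (conj z v - q v) := fun z hz => by
    have := continuous_conj hlam (hC z hz).2.2 (hC z hz).2.1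
    fun_prop
  have hdecomp : ∀ s ∈ C, ∀ t ∈ C, ∀ ω, semiDualGap ψ μ ν x y t ω - semiDualGap ψ μ ν x y s ω =
      empiricalGap μ x (fun v => ψ (t v - q v) - ψ (s v - q v)) ω +
        empiricalGap ν y (fun v => ψ (conj t v - q v) - ψ (conj s v - q v)) ω := by
    intro s hs t ht ω
    rw [← empiricalGap_sub hμ x (hzc t ht) (hzc s hs),
      ← empiricalGap_sub hν y (hcc t ht) (hcc s hs)]
    unfold semiDualGap
    ring
  have hnn : (0 : ℝ≥0) < n := by exact_mod_cast hn
  have hsqrt : 0 < NNReal.sqrt n := NNReal.sqrt_pos.2 hnn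
  have h := dudley_bound (P := P) (C := C) (t₀ := z₀) hz₀ (Z := semiDualGap ψ μ ν x y) (D := D)
    -- Each sample contributes a standard deviation Λε/√n and a deterministic bound 2Λε. The
    -- standard deviations are added because the two samples are not assumed independent of each
    -- other.
    (σ := 2 * Λ / NNReal.sqrt n) (B := 4 * Λ)
    (F := fun ω => realSemiDual ψ μ ν (zhat ω) - realSemiDual ψ μ ν z₀)
    (fun z hz => by
      refine edist_le_of_abs_sub_le fun v hv => le_trans ?_ hD
      have h1 := abs_le.1 ((hC z hz).1 R' v hv)
      have h2 := abs_le.1 ((hC z₀ hz₀).1 R' v hv)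
      rw [abs_le]
      constructor <;> linarith)
    hDpos (by positivity)
    (fun s hs t ht ε hst => by
      have hinc := fun v hv => abs_increments_le (v := v) hR' hRR' hGR' hlam hC ht hs hψl hst hv
      have h1 := hx.hasSubgaussianMGF (b := Λ * ε) hn ((hzc t ht).sub (hzc s hs)).measurable (by
        filter_upwards [ae_norm_le hμ] with v hv
        exact (hinc v hv).1)
      have h2 := hy.hasSubgaussianMGF (b := Λ * ε) hn ((hcc t ht).sub (hcc s hs)).measurable (by
        filter_upwards [ae_norm_le hν] with v hv
        exact (hinc v hv).2)
      have h3 := h1.add h2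
      have e : (NNReal.sqrt ((Λ * ε) ^ 2 / n) + NNReal.sqrt ((Λ * ε) ^ 2 / n)) ^ 2 =
          (2 * Λ / NNReal.sqrt n * ε) ^ 2 := by
        rw [NNReal.sqrt_div, NNReal.sqrt_sq]
        ring
      rw [e] at h3
      refine h3.congr (Eventually.of_forall fun ω => (hdecomp s hs t ht ω).symm))
    (by
      filter_upwards [hxR, hyR] with ω hxω hyω s hs t ht ε hst
      have hinc := fun v hv => abs_increments_le (v := v) hR' hRR' hGR' hlam hC ht hs hψl hst hv
      rw [hdecomp s hs t ht ω]
      have h1 := empiricalGap_le hμ hn hxω ((hzc t ht).sub (hzc s hs)) fun v hv => (hinc v hv).1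
      have h2 := empiricalGap_le hν hn hyω ((hcc t ht).sub (hcc s hs)) fun v hv => (hinc v hv).2
      refine (add_le_add h1 h2).trans (le_of_eq ?_)
      push_cast
      ring)
    (by
      filter_upwards [hxR, hyR, hzhat] with ω hxω hyω hω
      refine ⟨zhat ω, hω.1, ?_⟩
      have := isFiniteMeasure_empirical hn fun i => x i ω
      have := isFiniteMeasure_empirical hn fun i => y i ω
      have h1 := hω.2 z₀ hz₀
      rw [semiDual_eq (empirical_compl_closedBall hxω) (empirical_compl_closedBall hyω) hlam hC
          hω.1 hψ hψc,
        semiDual_eq (empirical_compl_closedBall hxω) (empirical_compl_closedBall hyω) hlam hC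
          hz₀ hψ hψc, EReal.coe_le_coe_iff] at h1
      rw [semiDualGap_eq, semiDualGap_eq]
      linarith) hδ hδD
  refine h.trans (le_of_eq ?_)
  have e1 : (2 * (4 * Λ : ℝ≥0) * δ : ℝ) = 8 * Λ * δ := by push_cast; ring
  have e2 : (12 * (2 * Λ / NNReal.sqrt n : ℝ≥0) : ℝ) = 24 * Λ / √n := by
    push_cast
    ring
  rw [e1, e2]
  rfl

end Main

end UOT

end

theorem mainTheorem2 (M : ℝ → ℝ) (R l lam : ℝ) (hlam : 0 < lam) :
    ∃ R' : ℝ, 0 < R' ∧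
    ∀ φ : ℝ≥0 → ℝ≥0∞, UOT.IsEntropy φ →
      UOT.ConjDifferentiableOn φ (UOT.argBound M R l lam) →
    ∃ M' L : ℝ, 0 < M' ∧ 0 < L ∧
    ∀ (d : ℕ) (X Y : Set (UOT.E d)) (μ ν : Measure (UOT.E d))
      (C : Set (UOT.E d → ℝ)) (z₀ : UOT.E d → ℝ) (C' : ℝ≥0),
      IsCompact X → IsCompact Y →
      IsProbabilityMeasure μ → IsProbabilityMeasure ν →
      μ Xᶜ = 0 → ν Yᶜ = 0 →
      μ (Metric.closedBall 0 R)ᶜ = 0 → ν (Metric.closedBall 0 R)ᶜ = 0 →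
      μ ≪ volume → ν ≪ volume →
      UOT.BoundedStronglyConvex M l lam C →
      UOT.IsPotential φ X Y μ ν z₀ → z₀ ∈ C →
      StrongConvexOn (Icc (-UOT.argBound M R l lam) (UOT.argBound M R l lam)) (C' : ℝ)
        (UOT.entropyConjReal φ) →
    ∀ (n : ℕ) (Ω : Type*) (_ : MeasurableSpace Ω) (P : Measure Ω)
      (x y : Fin n → Ω → UOT.E d) (zhat : Ω → UOT.E d → ℝ),
      0 < n → IsProbabilityMeasure P →
      UOT.IsSample P μ x → UOT.IsSample P ν y →
      (∀ᵐ ω ∂P, zhat ω ∈ C ∧ ∀ z ∈ C,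
        UOT.semiDual φ (UOT.empirical fun i => x i ω) (UOT.empirical fun i => y i ω) (zhat ω) ≤
          UOT.semiDual φ (UOT.empirical fun i => x i ω) (UOT.empirical fun i => y i ω) z) →
    ∀ δ : ℝ, 0 ≤ δ → δ ≤ M' / L →
      ∫⁻ ω, UOT.distSq φ lam C' μ ν z₀ (zhat ω) z₀ ∂P ≤
        64 * (ENNReal.ofReal δ + ENNReal.ofReal (1 / √(n : ℝ)) *
          ∫⁻ u in Icc (δ / 4) (M' / L), UOT.metricEntropy C R' (L * u) ^ (1 / 2 : ℝ)) := by
  -- The ball B_{R'} contains both B_R, where z is evaluated, and B_{G(R)}, where the maximizers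
  -- defining z^* lie.
  set R' : ℝ := |R| + |UOT.gradBound M l lam R| + 1
  have hR'0 : 0 < R' := by positivity
  have hRR' : R ≤ R' := by linarith [le_abs_self R, abs_nonneg (UOT.gradBound M l lam R)]
  have hGR' : UOT.gradBound M l lam R ≤ R' := by
    linarith [le_abs_self (UOT.gradBound M l lam R), abs_nonneg R]
  refine ⟨R', hR'0, fun φ hφ hdiff => ?_⟩
  -- A negative K is incompatible with a probability measure on B_R and a potential in C, so any
  -- constants do.
  rcases lt_or_ge (UOT.argBound M R l lam) 0 with hK | hK
  · refine ⟨1, 1, one_pos, one_pos, ?_⟩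
    intro d X Y μ ν C z₀ C' _ _ _ _ _ _ hμ _ _ _ hC _ hz₀
    exact absurd (UOT.argBound_nonneg hμ hC hz₀) (not_le.2 hK)
  obtain ⟨ψ, Λ, hΛ, hψm, hψl, hψ⟩ :=
    UOT.exists_monotone_lipschitz_extension hφ.one hK hdiff
  have hΛ' : (0 : ℝ) < Λ := hΛ
  set c : ℝ := 1 / lam ^ 2 + 2
  have hc0 : 0 < c := by positivity
  -- The choice cΛL = 1 cancels the stability and Lipschitz constants once Dudley's bound is used at
  -- scale Lδ, leaving the factors 8 and 24, both below 64.
  set L : ℝ := 1 / (c * Λ) with hL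
  have hL0 : 0 < L := by positivity
  have hcL : c * Λ * L = 1 := by rw [hL]; field_simp
  -- Two potentials in C differ by at most 2 M(R') on B_{R'}; the absolute value and the 1 ensure
  -- positivity.
  set D : ℝ≥0 := (2 * |M R'| + 1).toNNReal
  have hDr : (D : ℝ) = 2 * |M R'| + 1 := Real.coe_toNNReal _ (by positivity)
  have hD0 : (0 : ℝ) < D := by rw [hDr]; positivity
  have hDM : 2 * M R' ≤ D := by rw [hDr]; linarith [le_abs_self (M R')]
  refine ⟨D, L, hD0, hL0, ?_⟩
  intro d X Y μ ν C z₀ C' _ _ _ _ _ _ hμ hν _ _ hC hpot hz₀ hC' n Ω _ P x y zhat hn _ hx hy hzhat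
    δ hδ hδD
  have hLδD : L * δ ≤ D := by rw [mul_comm]; exact (le_div_iff₀ hL0).1 hδD
  have h1 := UOT.lintegral_excess_le hR'0 hRR' hGR' hμ hν hlam hC hz₀ hψ hψl hΛ hn hx hy hzhat
    hDM hD0 (mul_nonneg hL0.le hδ) hLδD
  have e1 : L * δ / 4 = L * (δ / 4) := by ring
  have e2 : (D : ℝ) = L * (D / L) := by field_simp
  set I := ∫⁻ u in Icc (δ / 4) (D / L), UOT.metricEntropy C R' (L * u) ^ (1 / 2 : ℝ)
  have e3 : ∫⁻ u in Icc (L * δ / 4) D, UOT.metricEntropy C R' u ^ (1 / 2 : ℝ) =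
      ENNReal.ofReal L * I := by
    rw [e1]
    nth_rewrite 1 [e2]
    exact UOT.setLIntegral_comp_mul_left hL0
      (fun u => UOT.metricEntropy C R' u ^ (1 / 2 : ℝ)) _ _
  rw [e3] at h1
  calc ∫⁻ ω, UOT.distSq φ lam C' μ ν z₀ (zhat ω) z₀ ∂P
      ≤ ∫⁻ ω, ENNReal.ofReal c * ENNReal.ofReal
          (UOT.realSemiDual ψ μ ν (zhat ω) - UOT.realSemiDual ψ μ ν z₀) ∂P := by
        refine lintegral_mono_ae ?_
        filter_upwards [hzhat] with ω hω
        exact hpot.distSq_le hμ hν hlam hC hz₀ hω.1 hψ hψm hψl hC'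
    _ ≤ ENNReal.ofReal c * (ENNReal.ofReal (8 * Λ * (L * δ)) +
          ENNReal.ofReal (24 * Λ / √n) * (ENNReal.ofReal L * I)) := by
        rw [lintegral_const_mul' _ _ ENNReal.ofReal_ne_top]
        gcongr
    _ = ENNReal.ofReal (8 * δ) + ENNReal.ofReal (24 * (1 / √n)) * I := by
        rw [mul_add, ← mul_assoc (ENNReal.ofReal (24 * Λ / √n)), ← mul_assoc (ENNReal.ofReal c),
          ← ENNReal.ofReal_mul (by positivity), ← ENNReal.ofReal_mul (by positivity),
          ← ENNReal.ofReal_mul (by positivity)]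
        rw [(by linear_combination 8 * δ * hcL : c * (8 * Λ * (L * δ)) = 8 * δ),
          (by linear_combination 24 * (1 / √n) * hcL :
            c * (24 * Λ / √n * L) = 24 * (1 / √n))]
    _ ≤ ENNReal.ofReal (64 * δ) + ENNReal.ofReal (64 * (1 / √n)) * I := by
        gcongr <;> norm_num
    _ = 64 * (ENNReal.ofReal δ + ENNReal.ofReal (1 / √n) * I) := by
        rw [ENNReal.ofReal_mul (by norm_num), ENNReal.ofReal_mul (by norm_num), mul_add, mul_assoc]
        norm_num
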